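/- Let $(M,L)$ be a Finsler manifold: $M$ is a finite-dimensional smooth manifold and $L:TM\to\mathbb R$ is continuous, smooth and positive on the slit tangent bundle $\mathcal TM$ of nonzero tangent vectors, positively homogeneous of degree $1$ on the fibres, with $g_u(v,w)=\tfrac12\,\partial_s\partial_t L^2(u+sv+tw)|_{s=t=0}$ positive definite for $u\in\mathcal TM$. Let $\pi:\mathcal TM\to M$ be the projection, and call smooth sections of the pullback bundle $\pi^{-1}(TM)\to\mathcal TM$ $\pi$-vector fields. Let $\eta(u)=(u,u)$, let $\rho:T(\mathcal TM)\to\pi^{-1}(TM)$ be the map given by $d\pi$, and let $\gamma:\pi^{-1}(TM)\to T(\mathcal TM)$ be the vertical lift. For a linear connection $\nabla$ on $\pi^{-1}(TM)$ put $K(W)=\nabla_W\eta$; $\nabla$ is regular if $T_u(\mathcal TM)=\ker\rho_u\oplus\ker K_u$ for every $u\in\mathcal TM$, and then $\beta=(\rho|_{\ker K})^{-1}$. Put $$\mathbf T(V,W)=\nabla_V\rho W-\nabla_W\rho V-\rho[V,W],\qquad \mathbf K(V,W)Z=-\nabla_V\nabla_WZ+\nabla_W\nabla_VZ+\nabla_{[V,W]}Z,$$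 $Q(X,Y)=\mathbf T(\beta X,\beta Y)$, $T(X,Y)=\mathbf T(\gamma X,\beta Y)$, $R(X,Y)=\mathbf K(\beta X,\beta Y)$, $P(X,Y)=\mathbf K(\beta X,\gamma Y)$, $S(X,Y)=\mathbf K(\gamma X,\gamma Y)$. Let $\nabla$ be the Cartan connection of $(M,L)$, i.e. the regular connection with $\nabla g=0$, $Q=0$ and $g(T(X,Y),Z)=g(T(X,Z),Y)$. Write $T(X,Y,Z)=g(T(X,Y),Z)$ and $A(X,Y,Z,W)=g(A(X,Y)Z,W)$ for $A=S,P,R$; $(\nabla_WA)(X,Y,Z)$ denotes the covariant derivative of the tensor $(X,Y,Z)\mapsto A(X,Y)Z$, and $\mathfrak A_{X,Y}\{B(X,Y)\}=B(X,Y)-B(Y,X)$. Let $\sigma,\psi$ be smooth functions on $M$, neither identically zero, regarded also as functions on $\mathcal TM$; put $\alpha(X)=d\sigma(\beta X)$ and $\mu(X)=d\psi(\beta X)$. Let $\zeta$ be a concircular $\pi$-vector field, i.e. a $\pi$-vector field with $\nabla_{\beta X}\zeta=\alpha(X)\zeta+\psi X$ and $\nabla_{\gamma X}\zeta=0$ for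 all $\pi$-vector fields $X$. Then for all $\pi$-vector fields $X,Y,Z$, on $\mathcal TM$: (a) $S(X,Y)\zeta=0$ and $S(X,Y,Z,\zeta)=0$. (b) $(\nabla_{\gamma Z}S)(X,Y,\zeta)=0$. (c) $(\nabla_{\beta Z}S)(X,Y,\zeta)=-\psi S(X,Y)Z$. (d) $(\nabla_{\beta\zeta}S)(X,Y,\zeta)=0$. (e) $P(X,Y)\zeta=\psi T(X,Y)$ and $P(X,Y,Z,\zeta)=-\psi T(X,Y,Z)$. (f) $(\nabla_{\gamma Z}P)(X,Y,\zeta)=\psi(\nabla_{\gamma Z}T)(X,Y)$. (g) $(\nabla_{\beta Z}P)(X,Y,\zeta)=(\mu(Z)-\psi\alpha(Z))T(X,Y)+\psi(\nabla_{\beta Z}T)(X,Y)-\psi P(X,Y)Z$. (h) $(\nabla_{\beta\zeta}P)(X,Y,\zeta)=(\mu(\zeta)-\psi\alpha(\zeta)-\psi^2)T(X,Y)+\psi(\nabla_{\beta\zeta}T)(X,Y)$. (i) $R(X,Y)\zeta=\mathfrak A_{X,Y}\{(\mu(Y)-\psi\alpha(Y))X\}$. (j) $R(X,Y,Z,\zeta)=\mathfrak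 A_{X,Y}\{(\mu(X)-\psi\alpha(X))g(Y,Z)\}$. (k) $(\nabla_{\gamma Z}R)(X,Y,\zeta)=-\mathfrak A_{X,Y}\{[\mu(T(Z,Y))-\psi\alpha(T(Z,Y))]X\}$. (l) $(\nabla_{\beta Z}R)(X,Y,\zeta)=\mathfrak A_{X,Y}\{((\nabla_{\beta Z}\mu)(Y)-\psi(\nabla_{\beta Z}\alpha)(Y)+\psi\alpha(Z)\alpha(Y))X\}-\mathfrak A_{X,Y}\{(\mu(Z)\alpha(Y)+\alpha(Z)\mu(Y))X\}-\psi R(X,Y)Z$. (m) $(\nabla_{\beta\zeta}R)(X,Y,\zeta)=\mathfrak A_{X,Y}\{((\nabla_{\beta\zeta}\mu)(Y)-\psi(\nabla_{\beta\zeta}\alpha)(Y))X\}-\mathfrak A_{X,Y}\{(\mu(\zeta)\alpha(Y)+\alpha(\zeta)\mu(Y))X\}+\mathfrak A_{X,Y}\{(\psi\alpha(\zeta)\alpha(Y)-\psi\mu(Y)+\psi^2\alpha(Y))X\}$. -/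

import Mathlib

open Bundle VectorField
open scoped Manifold ContDiff

noncomputable section

namespace PullbackFinsler

variable {E : Type*} [NormedAddCommGroup E] [NormedSpace ℝ E]
  {M : Type*} [TopologicalSpace M] [ChartedSpace E M] [IsManifold 𝓘(ℝ, E) ∞ M]

/-! ### The pullback bundle

`M` is a smooth manifold modelled on `E`. All objects live over the slit tangent bundle, i.e. over
the open set of nonzero tangent vectors: sections are functions on the whole tangent bundle whose
values at zero vectors are irrelevant. -/

/-- The projection `π : TM → M`, as a smooth map. -/
def proj (E M : Type*) [NormedAddCommGroup E] [NormedSpace ℝ E]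
    [TopologicalSpace M] [ChartedSpace E M] [IsManifold 𝓘(ℝ, E) ∞ M] :
    C^∞⟮𝓘(ℝ, E).tangent, TangentBundle 𝓘(ℝ, E) M; 𝓘(ℝ, E), M⟯ :=
  ⟨fun u => u.proj, Bundle.contMDiff_proj (TangentSpace 𝓘(ℝ, E))⟩

/-- The pullback bundle `π⁻¹(TM)` over `TM`; its fibre at `u` is `T_{π u} M`. -/
abbrev PiBundle (E M : Type*) [NormedAddCommGroup E] [NormedSpace ℝ E]
    [TopologicalSpace M] [ChartedSpace E M] [IsManifold 𝓘(ℝ, E) ∞ M] :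
    TangentBundle 𝓘(ℝ, E) M → Type _ :=
  (proj E M) *ᵖ (TangentSpace 𝓘(ℝ, E) : M → Type _)

instance (u : TangentBundle 𝓘(ℝ, E) M) : AddCommGroup (PiBundle E M u) :=
  inferInstanceAs (AddCommGroup (TangentSpace 𝓘(ℝ, E) (proj E M u)))

instance (u : TangentBundle 𝓘(ℝ, E) M) : IsTopologicalAddGroup (PiBundle E M u) :=
  inferInstanceAs (IsTopologicalAddGroup (TangentSpace 𝓘(ℝ, E) (proj E M u)))

instance (u : TangentBundle 𝓘(ℝ, E) M) : ContinuousSMul ℝ (PiBundle E M u) :=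
  inferInstanceAs (ContinuousSMul ℝ (TangentSpace 𝓘(ℝ, E) (proj E M u)))

/-- Sections of the pullback bundle (with no smoothness imposed). -/
abbrev PiField (E M : Type*) [NormedAddCommGroup E] [NormedSpace ℝ E]
    [TopologicalSpace M] [ChartedSpace E M] [IsManifold 𝓘(ℝ, E) ∞ M] : Type _ :=
  (u : TangentBundle 𝓘(ℝ, E) M) → PiBundle E M u

/-- Vector fields on `TM` (with no smoothness imposed). -/
abbrev TMField (E M : Type*) [NormedAddCommGroup E] [NormedSpace ℝ E]
    [TopologicalSpace M] [ChartedSpace E M] [IsManifold 𝓘(ℝ, E) ∞ M] : Type _ :=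
  (u : TangentBundle 𝓘(ℝ, E) M) → TangentSpace 𝓘(ℝ, E).tangent u

/-- The slit tangent bundle: the set of nonzero tangent vectors. -/
def slit (E M : Type*) [NormedAddCommGroup E] [NormedSpace ℝ E]
    [TopologicalSpace M] [ChartedSpace E M] : Set (TangentBundle 𝓘(ℝ, E) M) :=
  {u | u.snd ≠ 0}

/-- `π`-vector fields: smooth sections of the pullback bundle over the slit tangent bundle. -/
def IsPiVectorField (X : PiField E M) : Prop :=
  ContMDiffOn 𝓘(ℝ, E).tangent (𝓘(ℝ, E).tangent.prod 𝓘(ℝ, E)) ∞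
    (fun u => TotalSpace.mk' E u (X u)) (slit E M)

/-- The fibre of the pullback bundle at `u`, i.e. `T_{π u} M`, is by definition a copy of `E`. -/
def toModel (u : TangentBundle 𝓘(ℝ, E) M) : PiBundle E M u ≃L[ℝ] E :=
  ContinuousLinearEquiv.refl ℝ E

/-- A tangent vector `u`, seen as an element of the fibre `T_{π u} M = E`. -/
def vec (u : TangentBundle 𝓘(ℝ, E) M) : E := u.snd

/-- The inclusion of the fibre `T_x M = E` into `TM`; thus `fibreIncl u.proj (vec u) = u`. -/
def fibreIncl (x : M) (w : E) : TangentBundle 𝓘(ℝ, E) M := ⟨x, w⟩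

/-- The fundamental `π`-vector field `η(u) = (u, u)`. -/
def eta : PiField E M := fun u => u.snd

/-- The bundle morphism `ρ : T(TM) → π⁻¹(TM)`, given by the differential of `π`. -/
def rho (u : TangentBundle 𝓘(ℝ, E) M) :
    TangentSpace 𝓘(ℝ, E).tangent u →L[ℝ] PiBundle E M u :=
  mfderiv 𝓘(ℝ, E).tangent 𝓘(ℝ, E) (proj E M) u

/-- The bundle morphism `γ : π⁻¹(TM) → T(TM)`, i.e. the vertical lift: the differential at `u` of
the inclusion of the fibre through `u`. -/
def gam (u : TangentBundle 𝓘(ℝ, E) M) :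
    PiBundle E M u →L[ℝ] TangentSpace 𝓘(ℝ, E).tangent u :=
  (show E →L[ℝ] TangentSpace 𝓘(ℝ, E).tangent u from
    mfderiv 𝓘(ℝ, E) 𝓘(ℝ, E).tangent (fibreIncl (E := E) u.proj) (vec u)) ∘L
    (toModel u : PiBundle E M u →L[ℝ] E)

/-! ### Linear connections on the pullback bundle -/

/-- The underlying map of a connection; `D Y u w` is `D_w Y` for `w ∈ T_u(TM)`. -/
abbrev PiConnection (E M : Type*) [NormedAddCommGroup E] [NormedSpace ℝ E]
    [TopologicalSpace M] [ChartedSpace E M] [IsManifold 𝓘(ℝ, E) ∞ M] : Type _ :=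
  PiField E M → (u : TangentBundle 𝓘(ℝ, E) M) →
    TangentSpace 𝓘(ℝ, E).tangent u →L[ℝ] PiBundle E M u

/-- `D` is a smooth linear connection on the pullback bundle over the slit tangent bundle. -/
structure IsLinearConnection (D : PiConnection E M) : Prop where
  isCovariantDerivativeOn : IsCovariantDerivativeOn E D (slit E M)
  contMDiff : ContMDiffCovariantDerivativeOn E ∞ D (slit E M)

/-- `D_W Y` for a vector field `W` on `TM` and a section `Y`. -/
def along (D : PiConnection E M) (W : TMField E M) (Y : PiField E M) : PiField E M :=
  fun u => D Y u (W u)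

/-- The connection map `K w = D_w η`. -/
def connMap (D : PiConnection E M) (u : TangentBundle 𝓘(ℝ, E) M) :
    TangentSpace 𝓘(ℝ, E).tangent u →L[ℝ] PiBundle E M u :=
  D eta u

/-- `D` is regular: `T_u(TM) = V_u(TM) ⊕ H_u(TM)` with `V_u = ker dπ` and `H_u = ker K`. -/
def IsRegular (D : PiConnection E M) : Prop :=
  ∀ u ∈ slit E M,
    IsCompl (rho u).ker (connMap D u).ker

/-- The horizontal map `β = (ρ|_H)⁻¹` of a regular connection: `β v` is the horizontal vector `w`
at `u` with `ρ w = v`. -/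
def beta (D : PiConnection E M) (u : TangentBundle 𝓘(ℝ, E) M) (v : PiBundle E M u) :
    TangentSpace 𝓘(ℝ, E).tangent u :=
  Classical.epsilon fun w => connMap D u w = 0 ∧ rho u w = v

/-- The vector field `γ X` on `TM`. -/
def gamF (X : PiField E M) : TMField E M := fun u => gam u (X u)

/-- The vector field `β X` on `TM`. -/
def betaF (D : PiConnection E M) (X : PiField E M) : TMField E M := fun u => beta D u (X u)

/-- The section `ρ W`. -/
def rhoF (W : TMField E M) : PiField E M := fun u => rho u (W u)

/-- The classical torsion `D_V (ρ W) - D_W (ρ V) - ρ [V, W]`. -/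
def torsion (D : PiConnection E M) (V W : TMField E M) : PiField E M :=
  along D V (rhoF W) - along D W (rhoF V) - rhoF (mlieBracket 𝓘(ℝ, E).tangent V W)

/-- The (h)h-torsion `Q(X, Y)`. -/
def Q (D : PiConnection E M) (X Y : PiField E M) : PiField E M :=
  torsion D (betaF D X) (betaF D Y)

/-- The (h)hv-torsion `T(X, Y)`. -/
def T (D : PiConnection E M) (X Y : PiField E M) : PiField E M :=
  torsion D (gamF X) (betaF D Y)

/-- The classical curvature, with the sign convention
`-D_V D_W Z + D_W D_V Z + D_{[V, W]} Z`. -/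
def curvature (D : PiConnection E M) (V W : TMField E M) (Z : PiField E M) : PiField E M :=
  -along D V (along D W Z) + along D W (along D V Z)
    + along D (mlieBracket 𝓘(ℝ, E).tangent V W) Z

/-- The h-curvature `R(X, Y) Z`. -/
def R (D : PiConnection E M) (X Y Z : PiField E M) : PiField E M :=
  curvature D (betaF D X) (betaF D Y) Z

/-- The hv-curvature `P(X, Y) Z`. -/
def P (D : PiConnection E M) (X Y Z : PiField E M) : PiField E M :=
  curvature D (betaF D X) (gamF Y) Z

/-- The v-curvature `S(X, Y) Z`. -/
def S (D : PiConnection E M) (X Y Z : PiField E M) : PiField E M :=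
  curvature D (gamF X) (gamF Y) Z

/-! ### Covariant derivatives of tensors -/

/-- The derivative `W f` of a function `f` on `TM` along a vector field `W`. -/
def dirDeriv (W : TMField E M) (f : TangentBundle 𝓘(ℝ, E) M → ℝ) (u : TangentBundle 𝓘(ℝ, E) M) :
    ℝ :=
  mvfderiv 𝓘(ℝ, E).tangent f u (W u)

/-- `(D_W A)(X)` for a scalar `π`-form `A`. -/
def covForm (D : PiConnection E M) (W : TMField E M)
    (A : PiField E M → TangentBundle 𝓘(ℝ, E) M → ℝ) (X : PiField E M) :
    TangentBundle 𝓘(ℝ, E) M → ℝ :=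
  dirDeriv W (A X) - A (along D W X)

/-- `(D_W A)(X, Y)` for a vector-valued `π`-tensor `A` with two arguments. -/
def covTensor₂ (D : PiConnection E M) (W : TMField E M)
    (A : PiField E M → PiField E M → PiField E M) (X Y : PiField E M) : PiField E M :=
  along D W (A X Y) - A (along D W X) Y - A X (along D W Y)

/-- `(D_W A)(X, Y, Z)` for a vector-valued `π`-tensor `A` with three arguments. -/
def covTensor₃ (D : PiConnection E M) (W : TMField E M)
    (A : PiField E M → PiField E M → PiField E M → PiField E M) (X Y Z : PiField E M) :
    PiField E M :=
  along D W (A X Y Z) - A (along D W X) Y Z - A X (along D W Y) Z - A X Y (along D W Z)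

/-- The alternate sum `A(X, Y) - A(Y, X)`. -/
def altSum {B : Type*} [Sub B] (A : PiField E M → PiField E M → B) (X Y : PiField E M) : B :=
  A X Y - A Y X

/-! ### Finsler structures and the Cartan connection -/

/-- The metric defined by `L`: the Hessian at `u` of `L² / 2` restricted to the fibre through `u`.
-/
def metric (L : TangentBundle 𝓘(ℝ, E) M → ℝ) (u : TangentBundle 𝓘(ℝ, E) M)
    (v w : PiBundle E M u) : ℝ :=
  fderiv ℝ (fderiv ℝ fun y : E => L (fibreIncl u.proj y) ^ 2 / 2) (vec u) (toModel u v) (toModel u w)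

/-- The function `g(X, Y)` on `TM`. -/
def metricF (L : TangentBundle 𝓘(ℝ, E) M → ℝ) (X Y : PiField E M) :
    TangentBundle 𝓘(ℝ, E) M → ℝ :=
  fun u => metric L u (X u) (Y u)

/-- `L` is a Finsler structure on `M`. (That `L` vanishes on zero vectors follows from the
homogeneity.) -/
structure IsFinsler (L : TangentBundle 𝓘(ℝ, E) M → ℝ) : Prop where
  continuous : Continuous L
  contMDiffOn : ContMDiffOn 𝓘(ℝ, E).tangent 𝓘(ℝ, ℝ) ∞ L (slit E M)
  pos : ∀ u ∈ slit E M, 0 < L u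
  homogeneous : ∀ (x : M) (v : TangentSpace 𝓘(ℝ, E) x) (c : ℝ), 0 < c →
    L ⟨x, c • v⟩ = c * L ⟨x, v⟩
  posDef : ∀ u ∈ slit E M, ∀ v : PiBundle E M u, v ≠ 0 → 0 < metric L u v v

/-- `D` is the Cartan connection of `(M, L)`: the regular connection that is metric, has vanishing
(h)h-torsion, and satisfies `g(T(X, Y), Z) = g(T(X, Z), Y)`. -/
structure IsCartan (L : TangentBundle 𝓘(ℝ, E) M → ℝ) (D : PiConnection E M) : Prop where
  isLinearConnection : IsLinearConnection D
  isRegular : IsRegular D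
  metric_parallel : ∀ Y Z : PiField E M, IsPiVectorField Y → IsPiVectorField Z →
    ∀ u ∈ slit E M, ∀ w : TangentSpace 𝓘(ℝ, E).tangent u,
      mvfderiv 𝓘(ℝ, E).tangent (metricF L Y Z) u w
        = metric L u (D Y u w) (Z u) + metric L u (Y u) (D Z u w)
  hh_torsion : ∀ X Y : PiField E M, IsPiVectorField X → IsPiVectorField Y →
    ∀ u ∈ slit E M, Q D X Y u = 0
  hv_torsion : ∀ X Y Z : PiField E M, IsPiVectorField X → IsPiVectorField Y →
    IsPiVectorField Z → ∀ u ∈ slit E M, metricF L (T D X Y) Z u = metricF L (T D X Z) Y u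

/-- For a function `f` on `M`, the `π`-form `X ↦ d(f ∘ π)(β X)`. -/
def hForm (D : PiConnection E M) (f : M → ℝ) (X : PiField E M) : TangentBundle 𝓘(ℝ, E) M → ℝ :=
  dirDeriv (betaF D X) (f ∘ proj E M)

/-- `ζ` is a concircular `π`-vector field, with the associated functions `σ` and `ψ` on `M`:
`D_{β X} ζ = α(X) ζ + ψ X` with `α(X) = dσ(β X)`, and `D_{γ X} ζ = 0`. -/
structure IsConcircular (D : PiConnection E M) (σ ψ : M → ℝ) (ζ : PiField E M) : Prop where
  isPiVectorField : IsPiVectorField ζ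
  contMDiff_sigma : ContMDiff 𝓘(ℝ, E) 𝓘(ℝ, ℝ) ∞ σ
  contMDiff_psi : ContMDiff 𝓘(ℝ, E) 𝓘(ℝ, ℝ) ∞ ψ
  sigma_ne_zero : σ ≠ 0
  psi_ne_zero : ψ ≠ 0
  along_beta : ∀ X : PiField E M, IsPiVectorField X → ∀ u ∈ slit E M,
    along D (betaF D X) ζ u = hForm D σ X u • ζ u + ψ u.proj • X u
  along_gam : ∀ X : PiField E M, IsPiVectorField X → ∀ u ∈ slit E M, along D (gamF X) ζ u = 0

end PullbackFinsler

end

open Topology Filter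

noncomputable section

namespace PullbackFinsler

variable {E : Type*} [NormedAddCommGroup E] [NormedSpace ℝ E]
  {M : Type*} [TopologicalSpace M] [ChartedSpace E M] [IsManifold 𝓘(ℝ, E) ∞ M]

/-! ### Smoothness over the slit tangent bundle. -/

section

/-! Splitting a tangent vector into its `β` and `γ` parts turns the two concircular equations into
one: `D_W ζ = (Wσ) ζ + ψ ρW` for every `W`. Differentiating again and antisymmetrising, the
coefficient of `ζ` cancels because `[V, W]` is the commutator of derivations on `σ`, and what
remains is `K(V, W) ζ = (Wψ - ψ Wσ) ρV - (Vψ - ψ Vσ) ρW - ψ 𝐓(V, W)` (`IsConcircular.curvature_eq`).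

Vertical fields are killed by `ρ` and annihilate functions pulled back from `M`. Hence inserting `γ`
and `β` fields gives `S(X, Y)ζ = 0`, `P(X, Y)ζ = ψ T(X, Y)` and the formula for `R(X, Y)ζ`. The case
of `P` needs `T_symm`, which holds because `2 g(T(X, Y), Z)` is a third derivative of the energy in
the fibre; the case of `R` needs `Q = 0`. Identities with `ζ` in the last slot of the metric follow
from skew-symmetry of a metric curvature (`metric_curvature_left`).

For covariant derivatives, `(D_W A)(X, Y, ζ)` is the derivative of the two-argument tensor `A(·,
·)ζ` minus `A(X, Y) D_W ζ`. The last term vanishes for `W = γZ` and equals `α(Z) A(X, Y)ζ + ψ A(X,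
Y)Z` for `W = βZ`.

Much of the work is foundational: smoothness of `γX`, `βX` and `g(X, Y)`, the action of brackets on
functions, and the values of `ρ[γX, γY]` and `ρ[γX, βY]`. -/

lemma isOpen_slit : IsOpen (slit E M) := by
  rw [isOpen_iff_mem_nhds]
  intro u hu
  let e := trivializationAt E (TangentSpace 𝓘(ℝ, E)) u.proj
  have hb : u.proj ∈ e.baseSet := FiberBundle.mem_baseSet_trivializationAt' u.proj
  -- The trivialization is a linear isomorphism on each fibre, so being nonzero is seen by a
  -- continuous fibre coordinate.
  have key : ∀ v : TangentBundle 𝓘(ℝ, E) M, v.proj ∈ e.baseSet → ((e v).2 = 0 ↔ v.snd = 0) := by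
    intro v hv
    rw [← map_eq_zero_iff _ (e.continuousLinearEquivAt ℝ v.proj hv).injective]
    rfl
  have hc : ContinuousAt (fun v => (e v).2) u :=
    continuous_snd.continuousAt.comp (e.continuousAt (e.mem_source.2 hb))
  have h1 : ∀ᶠ v in 𝓝 u, (e v).2 ≠ 0 := hc.eventually_ne (by rw [Ne, key u hb]; exact hu)
  have h2 : ∀ᶠ v : TangentBundle 𝓘(ℝ, E) M in 𝓝 u, v.proj ∈ e.baseSet :=
    (FiberBundle.continuous_proj E (TangentSpace 𝓘(ℝ, E))).continuousAt.eventually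
      (e.open_baseSet.mem_nhds hb)
  filter_upwards [h1, h2] with v hv1 hv2 hv
  exact hv1 ((key v hv2).2 hv)

lemma slit_mem_nhds {u : TangentBundle 𝓘(ℝ, E) M} (hu : u ∈ slit E M) : slit E M ∈ 𝓝 u :=
  isOpen_slit.mem_nhds hu

/-- A section of the pullback bundle is smooth iff it is smooth as a map to `TM`. -/
lemma contMDiffAt_section_iff {X : PiField E M} {u : TangentBundle 𝓘(ℝ, E) M} :
    ContMDiffAt 𝓘(ℝ, E).tangent (𝓘(ℝ, E).tangent.prod 𝓘(ℝ, E)) ∞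
      (fun v => TotalSpace.mk' E v (X v)) u ↔
    ContMDiffAt 𝓘(ℝ, E).tangent 𝓘(ℝ, E).tangent ∞
      (fun v => (⟨v.proj, X v⟩ : TangentBundle 𝓘(ℝ, E) M)) u := by
  rw [Bundle.contMDiffAt_section, Bundle.contMDiffAt_totalSpace]
  exact ⟨fun h => ⟨(proj E M).contMDiff.contMDiffAt, h⟩, fun h => h.2⟩

/-- Smooth functions on the slit tangent bundle. -/
def IsSmoothFn (f : TangentBundle 𝓘(ℝ, E) M → ℝ) : Prop :=
  ContMDiffOn 𝓘(ℝ, E).tangent 𝓘(ℝ, ℝ) ∞ f (slit E M)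

/-- Smooth vector fields on the slit tangent bundle. -/
def IsSmoothTMField (V : TMField E M) : Prop :=
  ContMDiffOn 𝓘(ℝ, E).tangent 𝓘(ℝ, E).tangent.tangent ∞
    (fun u => (⟨u, V u⟩ : TangentBundle 𝓘(ℝ, E).tangent (TangentBundle 𝓘(ℝ, E) M))) (slit E M)

variable {X Y : PiField E M} {V W : TMField E M} {f h : TangentBundle 𝓘(ℝ, E) M → ℝ}
  {u : TangentBundle 𝓘(ℝ, E) M} {D : PiConnection E M}

lemma IsSmoothFn.contMDiffAt (hf : IsSmoothFn f) (hu : u ∈ slit E M) :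
    ContMDiffAt 𝓘(ℝ, E).tangent 𝓘(ℝ, ℝ) ∞ f u :=
  ContMDiffOn.contMDiffAt hf (slit_mem_nhds hu)

lemma IsSmoothFn.mdifferentiableAt (hf : IsSmoothFn f) (hu : u ∈ slit E M) :
    MDifferentiableAt 𝓘(ℝ, E).tangent 𝓘(ℝ, ℝ) f u :=
  (hf.contMDiffAt hu).mdifferentiableAt (by simp)

lemma IsSmoothTMField.contMDiffAt (hV : IsSmoothTMField V) (hu : u ∈ slit E M) :
    ContMDiffAt 𝓘(ℝ, E).tangent 𝓘(ℝ, E).tangent.tangent ∞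
    (fun u => (⟨u, V u⟩ : TangentBundle 𝓘(ℝ, E).tangent (TangentBundle 𝓘(ℝ, E) M))) u :=
  ContMDiffOn.contMDiffAt hV (slit_mem_nhds hu)

lemma IsPiVectorField.contMDiffAt (hX : IsPiVectorField X) (hu : u ∈ slit E M) :
    ContMDiffAt 𝓘(ℝ, E).tangent (𝓘(ℝ, E).tangent.prod 𝓘(ℝ, E)) ∞
      (fun v => TotalSpace.mk' E v (X v)) u :=
  ContMDiffOn.contMDiffAt hX (slit_mem_nhds hu)

lemma IsPiVectorField.mdifferentiableAt (hX : IsPiVectorField X) (hu : u ∈ slit E M) :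
    MDifferentiableAt 𝓘(ℝ, E).tangent (𝓘(ℝ, E).tangent.prod 𝓘(ℝ, E))
      (fun v => TotalSpace.mk' E v (X v)) u :=
  (hX.contMDiffAt hu).mdifferentiableAt (by simp)

lemma IsPiVectorField.congr (hX : IsPiVectorField X) (h : ∀ u ∈ slit E M, Y u = X u) :
    IsPiVectorField Y :=
  ContMDiffOn.congr hX fun u hu => by rw [h u hu]

lemma IsSmoothFn.congr (hf : IsSmoothFn f) (hh : ∀ u ∈ slit E M, h u = f u) : IsSmoothFn h :=
  ContMDiffOn.congr hf hh

lemma IsPiVectorField.add (hX : IsPiVectorField X) (hY : IsPiVectorField Y) :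
    IsPiVectorField (X + Y) := ContMDiffOn.add_section hX hY

lemma IsPiVectorField.sub (hX : IsPiVectorField X) (hY : IsPiVectorField Y) :
    IsPiVectorField (X - Y) := ContMDiffOn.sub_section hX hY

lemma IsPiVectorField.smul (hf : IsSmoothFn f) (hX : IsPiVectorField X) :
    IsPiVectorField (f • X) := ContMDiffOn.smul_section hf hX

lemma IsPiVectorField.zero : IsPiVectorField (0 : PiField E M) :=
  (Bundle.contMDiff_zeroSection ℝ (PiBundle E M)).contMDiffOn

lemma IsSmoothFn.mul (hf : IsSmoothFn f) (hh : IsSmoothFn h) : IsSmoothFn (f * h) :=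
  ContMDiffOn.mul hf hh

lemma IsSmoothFn.sub (hf : IsSmoothFn f) (hh : IsSmoothFn h) : IsSmoothFn (f - h) :=
  ContMDiffOn.sub hf hh

lemma isSmoothFn_comp_proj {φ : M → ℝ} (hφ : ContMDiff 𝓘(ℝ, E) 𝓘(ℝ, ℝ) ∞ φ) :
    IsSmoothFn (φ ∘ proj E M) :=
  (hφ.comp (proj E M).contMDiff).contMDiffOn

lemma isPiVectorField_eta : IsPiVectorField (eta : PiField E M) := fun _ _ =>
  (contMDiffAt_section_iff.2 contMDiffAt_id).contMDiffWithinAt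

lemma IsSmoothTMField.rhoF (hV : IsSmoothTMField V) : IsPiVectorField (rhoF V) := fun u hu =>
  (contMDiffAt_section_iff.2 (((proj E M).contMDiff.contMDiff_tangentMap (m := ∞) (by simp)).contMDiffAt.comp
    u (hV.contMDiffAt hu))).contMDiffWithinAt

lemma IsSmoothTMField.dirDeriv (hV : IsSmoothTMField V) (hf : IsSmoothFn f) :
    IsSmoothFn (dirDeriv V f) := by
  intro u hu
  have h1 : ContMDiffOn 𝓘(ℝ, E).tangent.tangent 𝓘(ℝ, ℝ).tangent ∞
      (tangentMapWithin 𝓘(ℝ, E).tangent 𝓘(ℝ, ℝ) f (slit E M)) _ :=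
    ContMDiffOn.contMDiffOn_tangentMapWithin hf (by simp) isOpen_slit.uniqueMDiffOn
  have h2 := h1.comp hV (fun v hv => hv)
  have h3 := (contMDiff_snd_tangentBundle_modelSpace (n := ∞) ℝ 𝓘(ℝ, ℝ)).comp_contMDiffOn h2
  refine (h3.congr fun v hv => ?_) u hu
  simp only [PullbackFinsler.dirDeriv, Function.comp, tangentMapWithin]
  rw [mfderivWithin_of_isOpen isOpen_slit hv]
  rfl

lemma IsLinearConnection.along (hD : IsLinearConnection D) (hV : IsSmoothTMField V)
    (hX : IsPiVectorField X) : IsPiVectorField (along D V X) := by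
  have := hD.contMDiff.contMDiff (σ := X) hX
  exact ContMDiffOn.clm_bundle_apply this hV

lemma IsSmoothTMField.mlieBracket [CompleteSpace E] (hV : IsSmoothTMField V)
    (hW : IsSmoothTMField W) :
    IsSmoothTMField (mlieBracket 𝓘(ℝ, E).tangent V W) := by
  intro u hu
  have : IsManifold 𝓘(ℝ, E).tangent (minSmoothness ℝ 2) (TangentBundle 𝓘(ℝ, E) M) :=
    .of_le (n := ∞) (by
      rw [minSmoothness_of_isRCLikeNormedField]
      exact WithTop.coe_le_coe.2 (le_top : (2 : ℕ∞) ≤ ⊤))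
  have : IsManifold 𝓘(ℝ, E).tangent (((⊤ : ℕ∞) : ℕ∞ω) + 1) (TangentBundle 𝓘(ℝ, E) M) :=
    inferInstanceAs (IsManifold 𝓘(ℝ, E).tangent ∞ (TangentBundle 𝓘(ℝ, E) M))
  have := ContMDiffAt.mlieBracket_vectorField (m := ⊤) (n := ⊤) (hV.contMDiffAt hu)
    (hW.contMDiffAt hu) (by simp)
  exact this.contMDiffWithinAt

end

/-! ### The vertical lift. -/

section

variable {X Y : PiField E M} {V W : TMField E M} {f h : TangentBundle 𝓘(ℝ, E) M → ℝ}
  {u : TangentBundle 𝓘(ℝ, E) M} {D : PiConnection E M}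

/-- The trivialization of `TM` around `x₀`, restricted to the fibre over `x`. -/
def fibreTriv (x₀ x : M) (hx : x ∈ (trivializationAt E (TangentSpace 𝓘(ℝ, E)) x₀).baseSet) :
    E ≃L[ℝ] E :=
  show TangentSpace 𝓘(ℝ, E) x ≃L[ℝ] E from
    (trivializationAt E (TangentSpace 𝓘(ℝ, E)) x₀).continuousLinearEquivAt ℝ x hx

lemma contMDiff_fibreIncl (x : M) :
    ContMDiff 𝓘(ℝ, E) 𝓘(ℝ, E).tangent ∞ (fibreIncl (E := E) x) := by
  intro y
  rw [Bundle.contMDiffAt_totalSpace]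
  refine ⟨contMDiffAt_const, ?_⟩
  exact (fibreTriv (E := E) x x (FiberBundle.mem_baseSet_trivializationAt' x) : E →L[ℝ] E).contMDiff.contMDiffAt

lemma mdifferentiableAt_fibreIncl (x : M) (y : E) :
    MDifferentiableAt 𝓘(ℝ, E) 𝓘(ℝ, E).tangent (fibreIncl (E := E) x) y :=
  (contMDiff_fibreIncl x).mdifferentiableAt (by simp)

omit [IsManifold 𝓘(ℝ, E) ∞ M] in
lemma fibreIncl_vec (u : TangentBundle 𝓘(ℝ, E) M) : fibreIncl u.proj (vec u) = u := rfl

/-- `π` is constant on each fibre. -/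
lemma rho_gam (u : TangentBundle 𝓘(ℝ, E) M) (v : PiBundle E M u) : rho u (gam u v) = 0 := by
  have h1 : mfderiv 𝓘(ℝ, E) 𝓘(ℝ, E) (proj E M ∘ fibreIncl u.proj) (vec u) = 
      (mfderiv 𝓘(ℝ, E).tangent 𝓘(ℝ, E) (proj E M) u).comp
      (mfderiv 𝓘(ℝ, E) 𝓘(ℝ, E).tangent (fibreIncl (E := E) u.proj) (vec u)) :=
    mfderiv_comp (vec u) ((proj E M).mdifferentiableAt)
      (mdifferentiableAt_fibreIncl u.proj (vec u))
  have h2 : mfderiv 𝓘(ℝ, E) 𝓘(ℝ, E) (proj E M ∘ fibreIncl (E := E) u.proj) (vec u) = 0 :=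
    mfderiv_const
  exact (congrArg (fun A : E →L[ℝ] E => A (toModel u v)) (h1.symm.trans h2))

/-- The fibre coordinate of a trivialization restricts to a linear isomorphism `A` on the fibre, and
by the chain rule `A` factors through `γ`. -/
lemma gam_injective (u : TangentBundle 𝓘(ℝ, E) M) : Function.Injective (gam u) := by
  let e := trivializationAt E (TangentSpace 𝓘(ℝ, E)) u.proj
  have hb : u.proj ∈ e.baseSet := FiberBundle.mem_baseSet_trivializationAt' u.proj
  let A := fibreTriv u.proj u.proj hb
  have he : MDifferentiableAt 𝓘(ℝ, E).tangent 𝓘(ℝ, E) (fun v => (e v).2) u :=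
    ((Bundle.contMDiffAt_totalSpace.1 (contMDiffAt_id (n := ∞) (I := 𝓘(ℝ, E).tangent)
      (x := u))).2).mdifferentiableAt (by simp)
  have h1 : mfderiv 𝓘(ℝ, E) 𝓘(ℝ, E) ((fun v => (e v).2) ∘ fibreIncl u.proj) (vec u) = 
      (mfderiv 𝓘(ℝ, E).tangent 𝓘(ℝ, E) (fun v => (e v).2) u).comp
      (mfderiv 𝓘(ℝ, E) 𝓘(ℝ, E).tangent (fibreIncl (E := E) u.proj) (vec u)) :=
    mfderiv_comp (vec u) he (mdifferentiableAt_fibreIncl u.proj (vec u))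
  have h2 : mfderiv 𝓘(ℝ, E) 𝓘(ℝ, E) ((fun v => (e v).2) ∘ fibreIncl (E := E) u.proj) (vec u)
      = (A : E →L[ℝ] E) := by
    rw [mfderiv_eq_fderiv]
    exact (A : E →L[ℝ] E).fderiv
  intro v w hvw
  apply A.injective
  have h3 := h1.symm.trans h2
  have h4 := congrArg (mfderiv 𝓘(ℝ, E).tangent 𝓘(ℝ, E) (fun v => (e v).2) u) hvw
  exact (congrArg (fun B : E →L[ℝ] E => B v) h3).symm.trans
    (h4.trans (congrArg (fun B : E →L[ℝ] E => B w) h3))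

/-- Translation along a section, as a map on `TM × ℝ`. -/
lemma contMDiffAt_translate (hX : IsPiVectorField X) (hu : u ∈ slit E M) :
    ContMDiffAt (𝓘(ℝ, E).tangent.prod 𝓘(ℝ, ℝ)) 𝓘(ℝ, E).tangent ∞
      (fun p : TangentBundle 𝓘(ℝ, E) M × ℝ => fibreIncl p.1.proj (vec p.1 + p.2 • toModel p.1 (X p.1)))
      (u, 0) := by
  rw [Bundle.contMDiffAt_totalSpace]
  have hπ : ContMDiffAt (𝓘(ℝ, E).tangent.prod 𝓘(ℝ, ℝ)) 𝓘(ℝ, E) ∞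
      (fun p : TangentBundle 𝓘(ℝ, E) M × ℝ => p.1.proj) (u, 0) :=
    (proj E M).contMDiff.contMDiffAt.comp (u, (0 : ℝ)) contMDiffAt_fst
  refine ⟨hπ, ?_⟩
  let e := trivializationAt E (TangentSpace 𝓘(ℝ, E)) u.proj
  have h1 : ContMDiffAt 𝓘(ℝ, E).tangent 𝓘(ℝ, E) ∞ (fun v => (e v).2) u :=
    ((Bundle.contMDiffAt_totalSpace.1 (contMDiffAt_id (n := ∞) (I := 𝓘(ℝ, E).tangent)
      (x := u))).2)
  have h2 : ContMDiffAt 𝓘(ℝ, E).tangent 𝓘(ℝ, E) ∞ (fun v => (e ⟨v.proj, X v⟩).2) u :=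
    (Bundle.contMDiffAt_totalSpace.1 (contMDiffAt_section_iff.1 (hX.contMDiffAt hu))).2
  have h3 : ContMDiffAt (𝓘(ℝ, E).tangent.prod 𝓘(ℝ, ℝ)) 𝓘(ℝ, E) ∞
      (fun p : TangentBundle 𝓘(ℝ, E) M × ℝ => (e p.1).2 + p.2 • (e ⟨p.1.proj, X p.1⟩).2) (u, 0) :=
    (h1.comp (u, (0 : ℝ)) contMDiffAt_fst).add
      (contMDiffAt_snd.smul (h2.comp (u, (0 : ℝ)) contMDiffAt_fst))
  refine h3.congr_of_eventuallyEq ?_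
  have hb : ∀ᶠ p : TangentBundle 𝓘(ℝ, E) M × ℝ in 𝓝 (u, 0), p.1.proj ∈ e.baseSet :=
    hπ.continuousAt.eventually (e.open_baseSet.mem_nhds (FiberBundle.mem_baseSet_trivializationAt' u.proj))
  filter_upwards [hb] with p hp
  let A := fibreTriv u.proj p.1.proj hp
  change A (vec p.1 + p.2 • toModel p.1 (X p.1)) = A (vec p.1) + p.2 • A (toModel p.1 (X p.1))
  rw [map_add, map_smul]

lemma hasMFDerivAt_translate (u : TangentBundle 𝓘(ℝ, E) M) (v : PiBundle E M u) :
    HasMFDerivAt 𝓘(ℝ, ℝ) 𝓘(ℝ, E).tangent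
      (fun s : ℝ => fibreIncl (E := E) u.proj (vec u + s • toModel u v)) 0
      (show ℝ →L[ℝ] E × E from ContinuousLinearMap.toSpanSingleton ℝ (gam u v : E × E)) := by
  have hc : HasFDerivAt (fun s : ℝ => vec u + s • toModel u v)
      (ContinuousLinearMap.toSpanSingleton ℝ (toModel u v)) 0 :=
    ((ContinuousLinearMap.toSpanSingleton ℝ (toModel u v)).hasFDerivAt).const_add (vec u)
  have h0 : vec u + (0 : ℝ) • toModel u v = vec u := by simp
  have hg : ∀ y : E, y = vec u → HasMFDerivAt 𝓘(ℝ, E) 𝓘(ℝ, E).tangent (fibreIncl u.proj) y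
      (show E →L[ℝ] E × E from mfderiv 𝓘(ℝ, E) 𝓘(ℝ, E).tangent (fibreIncl (E := E) u.proj) (vec u)) := by
    rintro y rfl
    exact (mdifferentiableAt_fibreIncl u.proj (vec u)).hasMFDerivAt
  have h1 := (hg _ h0).comp (0 : ℝ) hc.hasMFDerivAt
  refine h1.congr_mfderiv ?_
  apply ContinuousLinearMap.ext_ring
  have h2 : ContinuousLinearMap.toSpanSingleton ℝ (toModel u v) (1 : ℝ) = toModel u v := by simp
  have h3 : ContinuousLinearMap.toSpanSingleton ℝ (gam u v : E × E) (1 : ℝ) = gam u v :=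
    one_smul ℝ (gam u v : E × E)
  refine Eq.trans ?_ h3.symm
  exact congrArg (show E →L[ℝ] E × E from
    mfderiv 𝓘(ℝ, E) 𝓘(ℝ, E).tangent (fibreIncl (E := E) u.proj) (vec u)) h2

/-- `γX` is the derivative at `s = 0` of `u + s X(u)`, which is smooth jointly in `(u, s)`; a
partial derivative of such a family depends smoothly on the parameter `u`. -/
lemma IsPiVectorField.gamF (hX : IsPiVectorField X) : IsSmoothTMField (gamF X) := by
  intro u hu
  let ϕ : TangentBundle 𝓘(ℝ, E) M → ℝ →L[ℝ] E × E := fun v =>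
    ContinuousLinearMap.toSpanSingleton ℝ (gam v (X v) : E × E)
  have h1 := ContMDiffAt.mfderiv (m := ∞) (x₀ := u)
    (fun (v : TangentBundle 𝓘(ℝ, E) M) (s : ℝ) =>
      fibreIncl (E := E) v.proj (vec v + s • toModel v (X v))) (fun _ => (0 : ℝ))
    (contMDiffAt_translate hX hu) contMDiffAt_const (by simp)
  have h2 : ContMDiffAt 𝓘(ℝ, E).tangent 𝓘(ℝ, ℝ →L[ℝ] E × E) ∞
      (inTangentCoordinates 𝓘(ℝ, ℝ) 𝓘(ℝ, E).tangent (fun _ : TangentBundle 𝓘(ℝ, E) M => (0 : ℝ))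
        (fun v => v) ϕ u) u := by
    have e2 : (fun v : TangentBundle 𝓘(ℝ, E) M =>
        fibreIncl (E := E) v.proj (vec v + (0 : ℝ) • toModel v (X v))) = fun v => v := by
      funext v
      rw [zero_smul, add_zero, fibreIncl_vec]
    have e3 : (fun v : TangentBundle 𝓘(ℝ, E) M => (show ℝ →L[ℝ] E × E from
        mfderiv 𝓘(ℝ, ℝ) 𝓘(ℝ, E).tangent
          (fun s : ℝ => fibreIncl (E := E) v.proj (vec v + s • toModel v (X v))) 0)) = ϕ :=
      funext fun v => (hasMFDerivAt_translate v (X v)).mfderiv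
    have e4 := congrArg₂ (fun b φ => inTangentCoordinates 𝓘(ℝ, ℝ) 𝓘(ℝ, E).tangent
      (fun _ : TangentBundle 𝓘(ℝ, E) M => (0 : ℝ)) b φ u) e2 e3
    exact e4 ▸ h1
  -- The derivative in `s` is a linear map out of `ℝ`; evaluating it on the constant vector `1`
  -- recovers `γX`.
  have hv : ContMDiffAt 𝓘(ℝ, E).tangent 𝓘(ℝ, ℝ).tangent ∞
      (fun _ : TangentBundle 𝓘(ℝ, E) M => (⟨0, 1⟩ : TangentBundle 𝓘(ℝ, ℝ) ℝ)) u := contMDiffAt_const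
  have h3 := ContMDiffAt.clm_apply_of_inCoordinates (IM := 𝓘(ℝ, E).tangent)
    (E₁ := (TangentSpace 𝓘(ℝ, ℝ) : ℝ → Type))
    (E₂ := (TangentSpace 𝓘(ℝ, E).tangent : TangentBundle 𝓘(ℝ, E) M → Type _))
    (b₁ := fun _ => (0 : ℝ)) (b₂ := fun v : TangentBundle 𝓘(ℝ, E) M => v) (m₀ := u)
    (ϕ := ϕ)
    (v := fun _ => (1 : ℝ)) h2 hv contMDiffAt_id
  refine (h3.congr_of_eventuallyEq (Eventually.of_forall fun v => ?_)).contMDiffWithinAt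
  have : gam v (X v) = ϕ v (1 : ℝ) := (one_smul ℝ (gam v (X v) : E × E)).symm
  exact congrArg (fun w => (⟨v, w⟩ : TangentBundle 𝓘(ℝ, E).tangent (TangentBundle 𝓘(ℝ, E) M))) this

end

/-! ### Regularity and the horizontal map. -/

section

variable {X Y : PiField E M} {V W : TMField E M} {f h : TangentBundle 𝓘(ℝ, E) M → ℝ}
  {u : TangentBundle 𝓘(ℝ, E) M} {D : PiConnection E M}

/-- The map `w ↦ (ρ w, K w)` on `T_u(TM)`. -/
def rhoProd (D : PiConnection E M) (u : TangentBundle 𝓘(ℝ, E) M) : E × E →L[ℝ] E × E :=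
  (show E × E →L[ℝ] E from rho u).prod (show E × E →L[ℝ] E from connMap D u)

lemma rhoProd_injective (hD : IsRegular D) (hu : u ∈ slit E M) :
    Function.Injective (rhoProd D u) := by
  rw [injective_iff_map_eq_zero]
  intro w hw
  have h1 : rho u w = 0 := congrArg Prod.fst hw
  have h2 : connMap D u w = 0 := congrArg Prod.snd hw
  have := (hD u hu).disjoint
  exact Submodule.disjoint_def.1 this w h1 h2

variable [FiniteDimensional ℝ E]

/-- Source and target have the same finite dimension. Preimages of `(v, 0)` are the horizontal
lifts, so the choice in `beta` is never vacuous on the slit bundle. -/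
lemma rhoProd_surjective (hD : IsRegular D) (hu : u ∈ slit E M) :
    Function.Surjective (rhoProd D u) :=
  LinearMap.injective_iff_surjective.1 (rhoProd_injective hD hu : Function.Injective (rhoProd D u).toLinearMap)

lemma beta_spec (hD : IsRegular D) (hu : u ∈ slit E M) (v : PiBundle E M u) :
    connMap D u (beta D u v) = 0 ∧ rho u (beta D u v) = v := by
  refine Classical.epsilon_spec (p := fun w => connMap D u w = 0 ∧ rho u w = v) ?_
  obtain ⟨w, hw⟩ := rhoProd_surjective hD hu (v, 0)
  exact ⟨w, congrArg Prod.snd hw, congrArg Prod.fst hw⟩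

lemma connMap_beta (hD : IsRegular D) (hu : u ∈ slit E M) (v : PiBundle E M u) :
    connMap D u (beta D u v) = 0 := (beta_spec hD hu v).1

lemma rho_beta (hD : IsRegular D) (hu : u ∈ slit E M) (v : PiBundle E M u) :
    rho u (beta D u v) = v := (beta_spec hD hu v).2

/-- A dimension count: the image of `γ` lies in `ker ρ`, and both have the dimension of `E`. -/
lemma exists_gam_eq (hD : IsRegular D) (hu : u ∈ slit E M) (w : TangentSpace 𝓘(ℝ, E).tangent u)
    (hw : rho u w = 0) : ∃ v, gam u v = w := by
  let r : E × E →ₗ[ℝ] E := (rho u).toLinearMap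
  let g : E →ₗ[ℝ] E × E := (gam u).toLinearMap
  have hr : Function.Surjective r := fun v => ⟨beta D u v, rho_beta hD hu v⟩
  have hg : Function.Injective g := gam_injective u
  have h1 : LinearMap.range g ≤ LinearMap.ker r := by
    rintro _ ⟨v, rfl⟩
    exact rho_gam u v
  have h2 := r.finrank_range_add_finrank_ker
  rw [LinearMap.range_eq_top.2 hr, finrank_top, Module.finrank_prod] at h2
  have h3 := LinearMap.finrank_range_of_inj hg
  have h4 := Submodule.eq_of_le_of_finrank_eq h1 (by omega)
  have h5 : w ∈ LinearMap.ker r := hw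
  rw [← h4] at h5
  exact h5

lemma exists_eq_beta_add_gam (hD : IsRegular D) (hu : u ∈ slit E M)
    (w : TangentSpace 𝓘(ℝ, E).tangent u) : ∃ v, w = beta D u (rho u w) + gam u v := by
  obtain ⟨v, hv⟩ := exists_gam_eq hD hu (w - beta D u (rho u w)) (by
    rw [map_sub, rho_beta hD hu, sub_self])
  exact ⟨v, by rw [hv]; abel⟩

omit [FiniteDimensional ℝ E] in
lemma contMDiffAt_inCoordinates_rho (u : TangentBundle 𝓘(ℝ, E) M) :
    ContMDiffAt 𝓘(ℝ, E).tangent 𝓘(ℝ, E × E →L[ℝ] E) ∞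
      (fun v => ContinuousLinearMap.inCoordinates (E × E)
        (TangentSpace 𝓘(ℝ, E).tangent : TangentBundle 𝓘(ℝ, E) M → Type _) E (PiBundle E M)
        u v u v (rho v)) u :=
  ((proj E M).contMDiff.contMDiffAt).mfderiv_const (by simp)

omit [FiniteDimensional ℝ E] in
lemma contMDiffAt_inCoordinates_connMap (hD : IsLinearConnection D) (hu : u ∈ slit E M) :
    ContMDiffAt 𝓘(ℝ, E).tangent 𝓘(ℝ, E × E →L[ℝ] E) ∞
      (fun v => ContinuousLinearMap.inCoordinates (E × E)
        (TangentSpace 𝓘(ℝ, E).tangent : TangentBundle 𝓘(ℝ, E) M → Type _) E (PiBundle E M)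
        u v u v (connMap D v)) u := by
  have h1 := hD.contMDiff.contMDiff (σ := eta) isPiVectorField_eta
  exact ((contMDiffAt_hom_bundle _).1 (h1.contMDiffAt (slit_mem_nhds hu))).2

/-- In local coordinates `βX = B⁻¹(X, 0)`, where `B` represents `(ρ, K)`. The operator `B` depends
smoothly on the point, and inversion is smooth at invertible operators. -/
lemma IsPiVectorField.betaF (hD : IsLinearConnection D) (hD' : IsRegular D)
    (hX : IsPiVectorField X) : IsSmoothTMField (betaF D X) := by
  intro u hu
  apply ContMDiffAt.contMDiffWithinAt
  rw [Bundle.contMDiffAt_section]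
  let eT := trivializationAt (E × E)
    (TangentSpace 𝓘(ℝ, E).tangent : TangentBundle 𝓘(ℝ, E) M → Type _) u
  let eP := trivializationAt E (PiBundle E M) u
  let B : TangentBundle 𝓘(ℝ, E) M → E × E →L[ℝ] E × E := fun v =>
    (ContinuousLinearMap.inCoordinates (E × E)
        (TangentSpace 𝓘(ℝ, E).tangent : TangentBundle 𝓘(ℝ, E) M → Type _) E (PiBundle E M)
        u v u v (rho v)).prod (ContinuousLinearMap.inCoordinates (E × E)
        (TangentSpace 𝓘(ℝ, E).tangent : TangentBundle 𝓘(ℝ, E) M → Type _) E (PiBundle E M)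
        u v u v (connMap D v))
  have hB : ContMDiffAt 𝓘(ℝ, E).tangent 𝓘(ℝ, E × E →L[ℝ] E × E) ∞ B u := by
    have h1 := (contMDiffAt_inCoordinates_rho u).prodMk_space
      (contMDiffAt_inCoordinates_connMap hD hu)
    have h2 : ContDiff ℝ ∞ (fun p : (E × E →L[ℝ] E) × (E × E →L[ℝ] E) => p.1.prod p.2) :=
      (ContinuousLinearMap.prodₗᵢ (𝕜 := ℝ) (E := E × E) (F := E) (G := E) ℝ).contDiff
    exact h2.contMDiff.contMDiffAt.comp u h1
  have hbase : ∀ᶠ v in 𝓝 u, v ∈ eT.baseSet ∧ v ∈ eP.baseSet ∧ v ∈ slit E M := by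
    filter_upwards [eT.open_baseSet.mem_nhds (FiberBundle.mem_baseSet_trivializationAt' u),
      eP.open_baseSet.mem_nhds (FiberBundle.mem_baseSet_trivializationAt' u),
      slit_mem_nhds hu] with v h1 h2 h3 using ⟨h1, h2, h3⟩
  have hBapp : ∀ v (hT : v ∈ eT.baseSet) (hP : v ∈ eP.baseSet) (w : TangentSpace 𝓘(ℝ, E).tangent v),
      B v (eT.continuousLinearEquivAt ℝ v hT w) = (eP.continuousLinearEquivAt ℝ v hP (rho v w),
        eP.continuousLinearEquivAt ℝ v hP (connMap D v w)) := by
    intro v hT hP w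
    simp only [B]
    rw [ContinuousLinearMap.inCoordinates_eq hT hP, ContinuousLinearMap.inCoordinates_eq hT hP]
    simp only [ContinuousLinearMap.prod_apply, ContinuousLinearMap.comp_apply,
      ContinuousLinearEquiv.coe_coe]
    refine Prod.ext (congrArg (fun z => eP.continuousLinearEquivAt ℝ v hP (rho v z)) ?_)
      (congrArg (fun z => eP.continuousLinearEquivAt ℝ v hP (connMap D v z)) ?_) <;>
    exact (eT.continuousLinearEquivAt ℝ v hT).symm_apply_apply w
  have hBinv : ∀ᶠ v in 𝓝 u, (B v).IsInvertible := by
    filter_upwards [hbase] with v ⟨hT, hP, hv⟩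
    have hinj : Function.Injective (B v).toLinearMap := by
      rw [injective_iff_map_eq_zero]
      intro x hx
      obtain ⟨w, rfl⟩ := (eT.continuousLinearEquivAt ℝ v hT).surjective x
      have h1 := (hBapp v hT hP w).symm.trans hx
      have h2 := (map_eq_zero_iff _ (eP.continuousLinearEquivAt ℝ v hP).injective).1
        (congrArg Prod.fst h1)
      have h3 := (map_eq_zero_iff _ (eP.continuousLinearEquivAt ℝ v hP).injective).1
        (congrArg Prod.snd h1)
      rw [Submodule.disjoint_def.1 (hD' v hv).disjoint w h2 h3, map_zero]
    exact ⟨(LinearEquiv.ofInjectiveEndo _ hinj).toContinuousLinearEquiv, rfl⟩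
  have hX' : ContMDiffAt 𝓘(ℝ, E).tangent 𝓘(ℝ, E × E) ∞ (fun v => ((eP ⟨v, X v⟩).2, (0 : E))) u :=
    ((Bundle.contMDiffAt_section _).1 (hX.contMDiffAt hu)).prodMk_space contMDiffAt_const
  have hBi : ContMDiffAt 𝓘(ℝ, E).tangent 𝓘(ℝ, E × E →L[ℝ] E × E) ∞
      (fun v => (B v).inverse) u :=
    (hBinv.self_of_nhds.contDiffAt_map_inverse).contMDiffAt.comp u hB
  refine (hBi.clm_apply hX').congr_of_eventuallyEq ?_
  filter_upwards [hbase, hBinv] with v ⟨hT, hP, hv⟩ hi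
  have h1 := hBapp v hT hP (beta D v (X v))
  rw [rho_beta hD' hv, connMap_beta hD' hv, map_zero] at h1
  change eT.continuousLinearEquivAt ℝ v hT (beta D v (X v)) =
    (B v).inverse (eP.continuousLinearEquivAt ℝ v hP (X v), (0 : E))
  obtain ⟨e, he⟩ := hi
  rw [← h1, ← he, ContinuousLinearMap.inverse_equiv]
  exact (e.symm_apply_apply _).symm

end

section

variable {X Y : PiField E M} {U V W : TMField E M} {f h : TangentBundle 𝓘(ℝ, E) M → ℝ}
  {u : TangentBundle 𝓘(ℝ, E) M} {D : PiConnection E M}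

/-! ### Functions and Lie brackets -/

lemma IsSmoothTMField.mdifferentiableAt (hV : IsSmoothTMField V) (hu : u ∈ slit E M) :
    MDifferentiableAt 𝓘(ℝ, E).tangent 𝓘(ℝ, E).tangent.tangent
    (fun u => (⟨u, V u⟩ : TangentBundle 𝓘(ℝ, E).tangent (TangentBundle 𝓘(ℝ, E) M))) u :=
  (hV.contMDiffAt hu).mdifferentiableAt (by simp)

lemma IsSmoothTMField.smul (hf : IsSmoothFn f) (hV : IsSmoothTMField V) :
    IsSmoothTMField (f • V) := ContMDiffOn.smul_section hf hV

instance : IsManifold 𝓘(ℝ, E).tangent 2 (TangentBundle 𝓘(ℝ, E) M) :=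
  .of_le (n := ∞) (WithTop.coe_le_coe.2 (le_top : (2 : ℕ∞) ≤ ⊤))

instance : IsManifold 𝓘(ℝ, E).tangent (minSmoothness ℝ 3) (TangentBundle 𝓘(ℝ, E) M) := by
  rw [minSmoothness_of_isRCLikeNormedField]
  exact .of_le (n := ∞) (WithTop.coe_le_coe.2 (le_top : (3 : ℕ∞) ≤ ⊤))

section

variable [CompleteSpace E]

lemma mlieBracket_smul_right' (hf : IsSmoothFn f) (hW : IsSmoothTMField W) (hu : u ∈ slit E M) :
    mlieBracket 𝓘(ℝ, E).tangent V (f • W) u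
      = dirDeriv V f u • W u + f u • mlieBracket 𝓘(ℝ, E).tangent V W u :=
  mlieBracket_smul_right (hf.mdifferentiableAt hu) (hW.mdifferentiableAt hu)

/-- This expands the Jacobi identity for a rescaled field, from which `mvfderiv_mlieBracket`
extracts the action of a bracket on `f`. -/
lemma mlieBracket_smul_right_right (hf : IsSmoothFn f) (hV : IsSmoothTMField V) (hW : IsSmoothTMField W) (hu : u ∈ slit E M) :
    mlieBracket 𝓘(ℝ, E).tangent U (mlieBracket 𝓘(ℝ, E).tangent V (f • W)) u
      = dirDeriv U (dirDeriv V f) u • W u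
        + dirDeriv V f u • mlieBracket 𝓘(ℝ, E).tangent U W u
        + (dirDeriv U f u • mlieBracket 𝓘(ℝ, E).tangent V W u
        + f u • mlieBracket 𝓘(ℝ, E).tangent U (mlieBracket 𝓘(ℝ, E).tangent V W) u) := by
  have h1 : mlieBracket 𝓘(ℝ, E).tangent V (f • W) =ᶠ[𝓝 u]
      dirDeriv V f • W + f • mlieBracket 𝓘(ℝ, E).tangent V W := by
    filter_upwards [slit_mem_nhds hu] with v hv using mlieBracket_smul_right' hf hW hv
  rw [EventuallyEq.rfl.mlieBracket_vectorField_eq h1,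
    mlieBracket_add_right ((IsSmoothTMField.smul (hV.dirDeriv hf) hW).mdifferentiableAt hu)
      ((IsSmoothTMField.smul hf (hV.mlieBracket hW)).mdifferentiableAt hu),
    mlieBracket_smul_right' (hV.dirDeriv hf) hW hu,
    mlieBracket_smul_right' hf (hV.mlieBracket hW) hu]

/-- The Lie bracket acts on functions as the commutator of derivations. -/
lemma mvfderiv_mlieBracket (hf : IsSmoothFn f) (hV : IsSmoothTMField V) (hW : IsSmoothTMField W)
    (hu : u ∈ slit E M) :
    dirDeriv (mlieBracket 𝓘(ℝ, E).tangent V W) f u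
      = dirDeriv V (dirDeriv W f) u - dirDeriv W (dirDeriv V f) u := by
  -- The Liouville field `γη` vanishes nowhere on the slit bundle. The Jacobi identity for `V, W, f
  -- Z`, reduced by that for `V, W, Z`, leaves `([V, W]f - V(Wf) + W(Vf)) Z = 0`, so the scalar
  -- factor is zero.
  let Z : TMField E M := gamF eta
  have hZ : IsSmoothTMField Z := isPiVectorField_eta.gamF
  have hZu : Z u ≠ 0 := by
    intro h
    exact hu (gam_injective u (h.trans (map_zero (gam u)).symm))
  have h2 : ∀ {F : TMField E M}, IsSmoothTMField F → ContMDiffAt 𝓘(ℝ, E).tangent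
      𝓘(ℝ, E).tangent.tangent (minSmoothness ℝ 2) (fun u => (⟨u, F u⟩ :
      TangentBundle 𝓘(ℝ, E).tangent (TangentBundle 𝓘(ℝ, E) M))) u := by
    intro F hF
    rw [minSmoothness_of_isRCLikeNormedField]
    exact (hF.contMDiffAt hu).of_le (WithTop.coe_le_coe.2 (le_top : (2 : ℕ∞) ≤ ⊤))
  have j1 := leibniz_identity_mlieBracket_apply (h2 hV) (h2 hW) (h2 (IsSmoothTMField.smul hf hZ))
  have j2 := leibniz_identity_mlieBracket_apply (h2 hV) (h2 hW) (h2 hZ)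
  rw [mlieBracket_smul_right_right hf hW hZ hu, mlieBracket_smul_right_right hf hV hZ hu,
    mlieBracket_smul_right' hf hZ hu, j2] at j1
  have h3 : (dirDeriv (mlieBracket 𝓘(ℝ, E).tangent V W) f u
      - (dirDeriv V (dirDeriv W f) u - dirDeriv W (dirDeriv V f) u)) • Z u = 0 := by
    refine Eq.trans ?_ (neg_eq_zero.2 (sub_eq_zero.2 j1))
    module
  exact sub_eq_zero.1 ((smul_eq_zero.1 h3).resolve_right hZu)

end

/-- Every element of the pullback bundle extends to a smooth section. -/
lemma exists_isPiVectorField [FiniteDimensional ℝ E] [T2Space M] (u : TangentBundle 𝓘(ℝ, E) M)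
    (v : PiBundle E M u) : ∃ X : PiField E M, IsPiVectorField X ∧ X u = v := by
  let S : (x : M) → TangentSpace 𝓘(ℝ, E) x :=
    FiberBundle.extend E (show TangentSpace 𝓘(ℝ, E) u.proj from v)
  obtain ⟨s, hs, hs'⟩ := FiberBundle.exists_contMDiffOn_extend (k := ∞) 𝓘(ℝ, E) E
    (show TangentSpace 𝓘(ℝ, E) u.proj from v)
  obtain ⟨t, hts, ht, hut⟩ := mem_nhds_iff.1 hs
  obtain ⟨χ, -, hχ⟩ := (SmoothBumpFunction.nhds_basis_tsupport (I := 𝓘(ℝ, E)) u.proj).mem_iff.1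
    (ht.mem_nhds hut)
  -- A local extension on `M` is cut off by a bump function supported where it is smooth; the global
  -- section is then pulled back by `π`.
  have h1 := ContMDiffOn.smul_section_of_tsupport (I := 𝓘(ℝ, E)) (n := ∞) (s := S)
    (χ.contMDiff.contMDiffOn) ht hχ (hs'.mono hts)
  refine ⟨fun u' => χ u'.proj • S u'.proj, fun u' _ => ?_, ?_⟩
  · exact (contMDiffAt_section_iff.2
      (h1.contMDiffAt.comp u' (proj E M).contMDiff.contMDiffAt)).contMDiffWithinAt
  · have h2 : S u.proj = v := 
      FiberBundle.extend_apply_self E (show TangentSpace 𝓘(ℝ, E) u.proj from v)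
    change χ u.proj • S u.proj = v
    rw [χ.eq_one, one_smul, h2]

end

section

variable {X Y Z : PiField E M} {U V W : TMField E M} {f h : TangentBundle 𝓘(ℝ, E) M → ℝ}
  {u : TangentBundle 𝓘(ℝ, E) M} {D : PiConnection E M} {φ : M → ℝ}

/-! ### Derivatives of functions on the base and along the fibres -/

/-- The differential of a function on `M`, as a linear form on the pullback bundle. -/
def baseDeriv (φ : M → ℝ) (u : TangentBundle 𝓘(ℝ, E) M) : PiBundle E M u →L[ℝ] ℝ :=
  show E →L[ℝ] ℝ from mvfderiv 𝓘(ℝ, E) φ u.proj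

lemma mvfderiv_comp_proj (hφ : ContMDiff 𝓘(ℝ, E) 𝓘(ℝ, ℝ) ∞ φ)
    (w : TangentSpace 𝓘(ℝ, E).tangent u) :
    mvfderiv 𝓘(ℝ, E).tangent (φ ∘ proj E M) u w = baseDeriv φ u (rho u w) := by
  have h1 : mfderiv 𝓘(ℝ, E).tangent 𝓘(ℝ, ℝ) (φ ∘ proj E M) u =
      (mfderiv 𝓘(ℝ, E) 𝓘(ℝ, ℝ) φ u.proj).comp
      (mfderiv 𝓘(ℝ, E).tangent 𝓘(ℝ, E) (proj E M) u) :=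
    mfderiv_comp u (hφ.mdifferentiableAt (by simp)) ((proj E M).mdifferentiableAt)
  exact congrArg (fun A : E × E →L[ℝ] ℝ => A w) h1

lemma dirDeriv_comp_proj (hφ : ContMDiff 𝓘(ℝ, E) 𝓘(ℝ, ℝ) ∞ φ) :
    dirDeriv V (φ ∘ proj E M) u = baseDeriv φ u (rho u (V u)) :=
  mvfderiv_comp_proj hφ (V u)

lemma dirDeriv_gamF_comp_proj (hφ : ContMDiff 𝓘(ℝ, E) 𝓘(ℝ, ℝ) ∞ φ) :
    dirDeriv (gamF X) (φ ∘ proj E M) u = 0 := by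
  rw [dirDeriv_comp_proj hφ]
  have : rho u (gamF X u) = 0 := rho_gam u (X u)
  rw [this]
  exact map_zero (baseDeriv φ u)

lemma dirDeriv_congr (hfh : ∀ v ∈ slit E M, f v = h v) (hu : u ∈ slit E M) :
    dirDeriv V f u = dirDeriv V h u := by
  have h1 : f =ᶠ[𝓝 u] h := by filter_upwards [slit_mem_nhds hu] with v hv using hfh v hv
  simp only [dirDeriv, mvfderiv]
  have h2 := h1.mfderiv_eq (I := 𝓘(ℝ, E).tangent) (I' := 𝓘(ℝ, ℝ))
  exact congrArg (fun A : E × E →L[ℝ] ℝ => A (V u)) h2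

lemma hasFDerivAt_comp_fibreIncl (hf : MDifferentiableAt 𝓘(ℝ, E).tangent 𝓘(ℝ, ℝ) f u) :
    HasFDerivAt (fun y : E => f (fibreIncl u.proj y))
      (show E →L[ℝ] ℝ from (mvfderiv 𝓘(ℝ, E).tangent f u) ∘L (gam u)) (vec u) := by
  have h1 := HasMFDerivAt.comp (I := 𝓘(ℝ, E)) (I' := 𝓘(ℝ, E).tangent) (I'' := 𝓘(ℝ, ℝ)) (vec u) 
    (f := fibreIncl (E := E) u.proj) (g := f) hf.hasMFDerivAt
    (mdifferentiableAt_fibreIncl u.proj (vec u)).hasMFDerivAt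
  exact h1.hasFDerivAt

lemma dirDeriv_gamF (hf : MDifferentiableAt 𝓘(ℝ, E).tangent 𝓘(ℝ, ℝ) f u) :
    dirDeriv (gamF X) f u = fderiv ℝ (fun y : E => f (fibreIncl u.proj y)) (vec u) (toModel u (X u)) := by
  rw [(hasFDerivAt_comp_fibreIncl hf).fderiv]
  rfl

/-- Sections in a fixed fibre of `TM`. -/
def fibreSection (X : PiField E M) (x : M) (y : E) : E :=
  toModel (fibreIncl x y) (X (fibreIncl x y))

/-- The derivative of `Y` along `X` in the fibres of `TM`. -/
def vertDeriv (X Y : PiField E M) : PiField E M := fun u =>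
  (toModel u).symm (fderiv ℝ (fibreSection Y u.proj) (vec u) (toModel u (X u)))

lemma differentiableAt_fibreSection (hY : IsPiVectorField Y) (hu : u ∈ slit E M) :
    DifferentiableAt ℝ (fibreSection Y u.proj) (vec u) := by
  have hb := FiberBundle.mem_baseSet_trivializationAt' (F := E) (E := TangentSpace 𝓘(ℝ, E)) u.proj
  let A : E ≃L[ℝ] E := fibreTriv (E := E) u.proj u.proj hb
  have h1 : ContMDiffAt 𝓘(ℝ, E) 𝓘(ℝ, E) ∞ (fun y => A (fibreSection Y u.proj y)) (vec u) :=
    ContMDiffAt.comp (g := fun v => (trivializationAt E (PiBundle E M) u ⟨v, Y v⟩).2) (vec u)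
      ((Bundle.contMDiffAt_section _).1 (hY.contMDiffAt hu))
      (contMDiff_fibreIncl (E := E) u.proj).contMDiffAt
  have h2 : DifferentiableAt ℝ (fun y => A (fibreSection Y u.proj y)) (vec u) :=
    h1.contDiffAt.differentiableAt (by simp)
  have h3 := (A.symm : E →L[ℝ] E).differentiableAt.comp (vec u) h2
  refine h3.congr_of_eventuallyEq (Eventually.of_forall fun y => ?_)
  exact (A.symm_apply_apply _).symm

/-- The form `dφ` at `π u` does not change along the fibre, so only `Y` is differentiated. -/
lemma dirDeriv_gamF_baseDeriv (hY : IsPiVectorField Y) (hu : u ∈ slit E M)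
    (hs : IsSmoothFn (fun v => baseDeriv φ v (Y v))) :
    dirDeriv (gamF X) (fun v => baseDeriv φ v (Y v)) u = baseDeriv φ u (vertDeriv X Y u) := by
  rw [dirDeriv_gamF (hs.mdifferentiableAt hu)]
  let A : E →L[ℝ] ℝ := mvfderiv 𝓘(ℝ, E) φ u.proj
  have := A.hasFDerivAt.comp (vec u) (differentiableAt_fibreSection hY hu).hasFDerivAt
  exact congrArg (fun B : E →L[ℝ] ℝ => B (toModel u (X u))) this.fderiv

/-! ### Projections of brackets to the base, tested on functions. -/

section

variable [FiniteDimensional ℝ E] [T2Space M]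

/-- A chart has invertible differential; a linear functional not vanishing on the image of `w`,
composed with the chart and cut off by a bump function, gives `φ`. -/
lemma exists_mvfderiv_ne_zero (x : M) (w : TangentSpace 𝓘(ℝ, E) x) (hw : w ≠ 0) :
    ∃ φ : M → ℝ, ContMDiff 𝓘(ℝ, E) 𝓘(ℝ, ℝ) ∞ φ ∧ mvfderiv 𝓘(ℝ, E) φ x w ≠ 0 := by
  let A : E →L[ℝ] E := mfderiv 𝓘(ℝ, E) 𝓘(ℝ, E) (extChartAt 𝓘(ℝ, E) x) x
  have hA : A w ≠ 0 := by
    intro h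
    apply hw
    obtain ⟨e, he⟩ := isInvertible_mfderiv_extChartAt (I := 𝓘(ℝ, E)) (mem_extChartAt_source (I := 𝓘(ℝ, E)) x)
    apply e.injective
    rw [map_zero]
    exact (congrArg (fun B : E →L[ℝ] E => B w) he).trans h
  obtain ⟨ℓ, -, hℓ⟩ := exists_dual_vector ℝ (A w) (norm_ne_zero_iff.2 hA)
  obtain ⟨χ, -⟩ := (SmoothBumpFunction.nhds_basis_tsupport (I := 𝓘(ℝ, E)) x).ex_mem
  refine ⟨fun y => χ y • ℓ (extChartAt 𝓘(ℝ, E) x y), ?_, ?_⟩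
  · refine χ.contMDiff_smul ?_
    exact ℓ.contMDiff.comp_contMDiffOn contMDiffOn_extChartAt
  · have h1 : (fun y => χ y • ℓ (extChartAt 𝓘(ℝ, E) x y)) =ᶠ[𝓝 x]
        (ℓ ∘ extChartAt 𝓘(ℝ, E) x) := by
      filter_upwards [χ.eventuallyEq_one] with y hy
      simp [hy]
    have h2 := h1.mfderiv_eq (I := 𝓘(ℝ, E)) (I' := 𝓘(ℝ, ℝ))
    have h3 : mfderiv 𝓘(ℝ, E) 𝓘(ℝ, ℝ) (ℓ ∘ extChartAt 𝓘(ℝ, E) x) x =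
      (mfderiv 𝓘(ℝ, E) 𝓘(ℝ, ℝ) ℓ (extChartAt 𝓘(ℝ, E) x x)).comp
      (mfderiv 𝓘(ℝ, E) 𝓘(ℝ, E) (extChartAt 𝓘(ℝ, E) x) x) :=
      mfderiv_comp x ℓ.differentiableAt.mdifferentiableAt (mdifferentiableAt_extChartAt (mem_chart_source E x))
    have h4 : mvfderiv 𝓘(ℝ, E) (fun y => χ y • ℓ (extChartAt 𝓘(ℝ, E) x y)) x w = ℓ (A w) := by
      have h5 := h2.trans h3
      rw [mfderiv_eq_fderiv, ℓ.fderiv] at h5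
      exact congrArg (fun B : E →L[ℝ] ℝ => B w) h5
    rw [h4, hℓ]
    simpa using hA

lemma eq_of_forall_baseDeriv_eq {v w : PiBundle E M u}
    (h : ∀ φ : M → ℝ, ContMDiff 𝓘(ℝ, E) 𝓘(ℝ, ℝ) ∞ φ → baseDeriv φ u v = baseDeriv φ u w) :
    v = w := by
  by_contra hvw
  obtain ⟨φ, hφ, h1⟩ := exists_mvfderiv_ne_zero u.proj (show E from v - w) (sub_ne_zero.2 hvw)
  refine h1 ((map_sub (baseDeriv φ u) v w).trans ?_)
  rw [h φ hφ, sub_self]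

/-- Both fields annihilate functions pulled back from `M`, hence so does their commutator. -/
lemma rho_mlieBracket_gamF_gamF (hX : IsPiVectorField X) (hY : IsPiVectorField Y)
    (hu : u ∈ slit E M) : rhoF (mlieBracket 𝓘(ℝ, E).tangent (gamF X) (gamF Y)) u = 0 := by
  have : CompleteSpace E := FiniteDimensional.complete ℝ E
  refine eq_of_forall_baseDeriv_eq fun φ hφ => ?_
  have h1 := mvfderiv_mlieBracket (isSmoothFn_comp_proj hφ) hX.gamF hY.gamF hu
  rw [dirDeriv_comp_proj hφ] at h1
  refine h1.trans ?_
  have h2 : ∀ {A B : PiField E M}, dirDeriv (gamF A) (dirDeriv (gamF B) (φ ∘ proj E M)) u = 0 := by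
    intro A B
    rw [dirDeriv_congr (h := (fun _ => 0) ∘ proj E M) (fun v _ => dirDeriv_gamF_comp_proj hφ) hu,
      dirDeriv_gamF_comp_proj contMDiff_const]
  rw [h2, h2, sub_zero]
  exact (map_zero (baseDeriv φ u)).symm

/-- On `φ ∘ π` the field `γX` gives `0` and `βY` gives `dφ(Y)`, so the commutator reduces to the
fibre derivative of `dφ(Y)`. -/
lemma rho_mlieBracket_gamF_betaF (hD : IsLinearConnection D) (hD' : IsRegular D)
    (hX : IsPiVectorField X) (hY : IsPiVectorField Y) (hu : u ∈ slit E M) :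
    rhoF (mlieBracket 𝓘(ℝ, E).tangent (gamF X) (betaF D Y)) u = vertDeriv X Y u := by
  have : CompleteSpace E := FiniteDimensional.complete ℝ E
  refine eq_of_forall_baseDeriv_eq fun φ hφ => ?_
  have hβ := hY.betaF hD hD'
  have h1 := mvfderiv_mlieBracket (isSmoothFn_comp_proj hφ) hX.gamF hβ hu
  rw [dirDeriv_comp_proj hφ] at h1
  refine h1.trans ?_
  have h2 : ∀ v ∈ slit E M, dirDeriv (betaF D Y) (φ ∘ proj E M) v = baseDeriv φ v (Y v) := by
    intro v hv
    rw [dirDeriv_comp_proj hφ]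
    exact congrArg _ (rho_beta hD' hv (Y v))
  have h3 : dirDeriv (betaF D Y) (dirDeriv (gamF X) (φ ∘ proj E M)) u = 0 := by
    rw [dirDeriv_congr (h := (fun _ => 0) ∘ proj E M) (fun v _ => dirDeriv_gamF_comp_proj hφ) hu,
      dirDeriv_comp_proj contMDiff_const, baseDeriv, mvfderiv_const]
    rfl
  rw [h3, sub_zero, dirDeriv_congr h2 hu]
  exact dirDeriv_gamF_baseDeriv hY hu
    ((hβ.dirDeriv (isSmoothFn_comp_proj hφ)).congr fun v hv => (h2 v hv).symm)

end

end

section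

variable {X Y Z : PiField E M} {U V W : TMField E M} {f h : TangentBundle 𝓘(ℝ, E) M → ℝ}
  {u : TangentBundle 𝓘(ℝ, E) M} {D : PiConnection E M} {L : TangentBundle 𝓘(ℝ, E) M → ℝ}

/-! ### Rules for the connection -/

lemma IsLinearConnection.congr (hD : IsLinearConnection D) (hX : IsPiVectorField X)
    (h : ∀ v ∈ slit E M, Y v = X v) (hu : u ∈ slit E M) : D Y u = D X u :=
  hD.isCovariantDerivativeOn.congr_of_eqOn ((hX.congr h).mdifferentiableAt hu)
    (hX.mdifferentiableAt hu) (slit_mem_nhds hu) h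

lemma IsLinearConnection.add (hD : IsLinearConnection D) (hX : IsPiVectorField X)
    (hY : IsPiVectorField Y) (hu : u ∈ slit E M) : D (X + Y) u = D X u + D Y u :=
  hD.isCovariantDerivativeOn.add (hX.mdifferentiableAt hu) (hY.mdifferentiableAt hu) hu

lemma IsLinearConnection.zero (hD : IsLinearConnection D) (hu : u ∈ slit E M) :
    D 0 u = 0 := hD.isCovariantDerivativeOn.zero hu

lemma IsLinearConnection.along_smul (hD : IsLinearConnection D) (hf : IsSmoothFn f)
    (hX : IsPiVectorField X) (hu : u ∈ slit E M) :
    PullbackFinsler.along D W (f • X) u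
      = f u • PullbackFinsler.along D W X u + dirDeriv W f u • X u := by
  have := hD.isCovariantDerivativeOn.leibniz (hX.mdifferentiableAt hu) (hf.mdifferentiableAt hu) hu
  exact congrArg (fun A => A (W u)) this

lemma IsLinearConnection.along_add (hD : IsLinearConnection D) (hX : IsPiVectorField X)
    (hY : IsPiVectorField Y) (hu : u ∈ slit E M) :
    PullbackFinsler.along D W (X + Y) u
      = PullbackFinsler.along D W X u + PullbackFinsler.along D W Y u :=
  congrArg (fun A => A (W u)) (hD.add hX hY hu)

lemma IsLinearConnection.along_congr (hD : IsLinearConnection D) (hX : IsPiVectorField X)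
    (h : ∀ v ∈ slit E M, Y v = X v) (hu : u ∈ slit E M) :
    PullbackFinsler.along D W Y u = PullbackFinsler.along D W X u :=
  congrArg (fun A => A (W u)) (hD.congr hX h hu)

lemma IsLinearConnection.along_eq_zero (hD : IsLinearConnection D)
    (h : ∀ v ∈ slit E M, Y v = 0) (hu : u ∈ slit E M) :
    PullbackFinsler.along D W Y u = 0 := by
  rw [hD.along_congr IsPiVectorField.zero h hu]
  exact congrArg (fun A => A (W u)) (hD.zero hu)

/-! ### The metric -/

/-- Half of the square of the Finsler function, in a fixed fibre. -/
def fibreEnergy (L : TangentBundle 𝓘(ℝ, E) M → ℝ) (x : M) (y : E) : ℝ :=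
  L (fibreIncl x y) ^ 2 / 2

/-- The metric as a continuous bilinear form on `E`. -/
def hess (L : TangentBundle 𝓘(ℝ, E) M → ℝ) (u : TangentBundle 𝓘(ℝ, E) M) : E →L[ℝ] E →L[ℝ] ℝ :=
  fderiv ℝ (fderiv ℝ (fibreEnergy L u.proj)) (vec u)

lemma metric_eq_hess (v w : PiBundle E M u) : metric L u v w = hess L u (toModel u v) (toModel u w) :=
  rfl

lemma metric_add_left (v v' w : PiBundle E M u) :
    metric L u (v + v') w = metric L u v w + metric L u v' w := by
  simp only [metric_eq_hess, map_add, add_apply]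

lemma metric_sub_left (v v' w : PiBundle E M u) :
    metric L u (v - v') w = metric L u v w - metric L u v' w := by
  simp only [metric_eq_hess, map_sub, sub_apply]

lemma metric_neg_left (v w : PiBundle E M u) :
    metric L u (-v) w = -metric L u v w := by
  simp only [metric_eq_hess, map_neg, neg_apply]

lemma metric_smul_left (c : ℝ) (v w : PiBundle E M u) :
    metric L u (c • v) w = c * metric L u v w := by
  simp only [metric_eq_hess, map_smul, smul_apply, smul_eq_mul]

lemma IsFinsler.isSmoothFn (hL : IsFinsler L) : IsSmoothFn (fun v => L v ^ 2 / 2) :=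
  (hL.contMDiffOn.pow 2).div_const 2

lemma IsFinsler.contDiffAt (hL : IsFinsler L) (hu : u ∈ slit E M) :
    ContDiffAt ℝ ∞ (fibreEnergy L u.proj) (vec u) :=
  (ContMDiffAt.comp (g := fun v => L v ^ 2 / 2) (vec u) (hL.isSmoothFn.contMDiffAt hu)
    (contMDiff_fibreIncl (E := E) u.proj).contMDiffAt).contDiffAt

lemma IsFinsler.contDiffAt_fderiv (hL : IsFinsler L) (hu : u ∈ slit E M) :
    ContDiffAt ℝ ∞ (fderiv ℝ (fibreEnergy L u.proj)) (vec u) :=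
  (hL.contDiffAt hu).fderiv_right (by simp)

lemma IsFinsler.contDiffAt_fderiv_fderiv (hL : IsFinsler L) (hu : u ∈ slit E M) :
    ContDiffAt ℝ ∞ (fderiv ℝ (fderiv ℝ (fibreEnergy L u.proj))) (vec u) :=
  (hL.contDiffAt_fderiv hu).fderiv_right (by simp)

lemma IsFinsler.metric_symm (hL : IsFinsler L) (hu : u ∈ slit E M) (v w : PiBundle E M u) :
    metric L u v w = metric L u w v :=
  ((hL.contDiffAt hu).isSymmSndFDerivAt (by
    rw [minSmoothness_of_isRCLikeNormedField]
    exact WithTop.coe_le_coe.2 (le_top : (2 : ℕ∞) ≤ ⊤))) _ _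

/-- Third derivatives of the energy in the fibres. -/
def cartanForm (L : TangentBundle 𝓘(ℝ, E) M → ℝ) (u : TangentBundle 𝓘(ℝ, E) M)
    (a b c : PiBundle E M u) : ℝ :=
  fderiv ℝ (fderiv ℝ (fderiv ℝ (fibreEnergy L u.proj))) (vec u) (toModel u a) (toModel u b)
    (toModel u c)

lemma IsFinsler.cartanForm_symm (hL : IsFinsler L) (hu : u ∈ slit E M) (a b c : PiBundle E M u) :
    cartanForm L u a b c = cartanForm L u b a c :=
  congrArg (fun A : E →L[ℝ] ℝ => A (toModel u c))
    (((hL.contDiffAt_fderiv hu).isSymmSndFDerivAt (by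
    rw [minSmoothness_of_isRCLikeNormedField]
    exact WithTop.coe_le_coe.2 (le_top : (2 : ℕ∞) ≤ ⊤))) _ _)

/-- The product rule within a fibre for the Hessian applied to `Y` and `Z`; differentiating the
Hessian gives the third-derivative term. -/
lemma dirDeriv_gamF_metricF (hL : IsFinsler L) (hY : IsPiVectorField Y) (hZ : IsPiVectorField Z)
    (hg : IsSmoothFn (metricF L Y Z)) (hu : u ∈ slit E M) :
    dirDeriv (gamF X) (metricF L Y Z) u = cartanForm L u (X u) (Y u) (Z u)
      + metric L u (vertDeriv X Y u) (Z u) + metric L u (Y u) (vertDeriv X Z u) := by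
  rw [dirDeriv_gamF (hg.mdifferentiableAt hu)]
  have h1 := (((hL.contDiffAt_fderiv_fderiv hu).differentiableAt (by simp)).hasFDerivAt.clm_apply
    (differentiableAt_fibreSection hY hu).hasFDerivAt).clm_apply
    (differentiableAt_fibreSection hZ hu).hasFDerivAt
  refine (congrArg (fun B : E →L[ℝ] ℝ => B (toModel u (X u))) h1.fderiv).trans ?_
  simp only [add_apply, ContinuousLinearMap.comp_apply,
    ContinuousLinearMap.flip_apply]
  rw [add_comm]
  congr 1
  rw [add_comm]
  rfl

/-- It expresses `g(X, Y)` through derivatives of the energy along fields on `TM`, which is how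
`IsSmoothFn.metricF` obtains smoothness transverse to the fibres as well. -/
lemma dirDeriv_gamF_gamF_energy (hL : IsFinsler L) (hY : IsPiVectorField Y) (hu : u ∈ slit E M) :
    dirDeriv (gamF X) (dirDeriv (gamF Y) (fun v => L v ^ 2 / 2)) u
      = metricF L X Y u + dirDeriv (gamF (vertDeriv X Y)) (fun v => L v ^ 2 / 2) u := by
  rw [dirDeriv_gamF ((hY.gamF.dirDeriv hL.isSmoothFn).mdifferentiableAt hu),
    dirDeriv_gamF (hL.isSmoothFn.mdifferentiableAt hu)]
  have h1 := ((hL.contDiffAt_fderiv hu).differentiableAt (by simp)).hasFDerivAt.clm_apply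
    (differentiableAt_fibreSection hY hu).hasFDerivAt
  have hev : (fun y : E => dirDeriv (gamF Y) (fun v => L v ^ 2 / 2) (fibreIncl u.proj y))
      =ᶠ[𝓝 (vec u)] fun y => fderiv ℝ (fibreEnergy L u.proj) y (fibreSection Y u.proj y) := by
    filter_upwards [(contMDiff_fibreIncl (E := E) u.proj).continuous.continuousAt.preimage_mem_nhds
      (slit_mem_nhds (u := fibreIncl u.proj (vec u)) hu)] with y hy
    exact dirDeriv_gamF (hL.isSmoothFn.mdifferentiableAt hy)
  rw [hev.fderiv_eq, h1.fderiv]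
  simp only [add_apply, ContinuousLinearMap.comp_apply,
    ContinuousLinearMap.flip_apply]
  rw [add_comm]
  rfl

lemma isPiVectorField_torsion [FiniteDimensional ℝ E] (hD : IsLinearConnection D) (hV : IsSmoothTMField V)
    (hW : IsSmoothTMField W) : IsPiVectorField (torsion D V W) := by
  have : CompleteSpace E := FiniteDimensional.complete ℝ E
  exact ((hD.along hV hW.rhoF).sub (hD.along hW hV.rhoF)).sub (hV.mlieBracket hW).rhoF

/-! ### The metric as a smooth tensor and the symmetry of `T`. -/

section

variable [FiniteDimensional ℝ E] [T2Space M]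

lemma IsSmoothFn.metricF (hL : IsFinsler L) (hD : IsLinearConnection D) (hD' : IsRegular D)
    (hX : IsPiVectorField X) (hY : IsPiVectorField Y) : IsSmoothFn (metricF L X Y) := by
  have : CompleteSpace E := FiniteDimensional.complete ℝ E
  -- The fibrewise derivative is smooth on all of the slit bundle because it equals `ρ[γX, βY]`.
  have hv : IsPiVectorField (vertDeriv X Y) :=
    (hX.gamF.mlieBracket (hY.betaF hD hD')).rhoF.congr
      fun u hu => (rho_mlieBracket_gamF_betaF hD hD' hX hY hu).symm
  refine ((hX.gamF.dirDeriv (hY.gamF.dirDeriv hL.isSmoothFn)).sub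
    (hv.gamF.dirDeriv hL.isSmoothFn)).congr fun u hu => ?_
  rw [Pi.sub_apply, dirDeriv_gamF_gamF_energy hL hY hu, add_sub_cancel_right]

lemma T_eq (hD : IsLinearConnection D) (hD' : IsRegular D)
    (hX : IsPiVectorField X) (hY : IsPiVectorField Y) (hu : u ∈ slit E M) :
    T D X Y u = along D (gamF X) Y u - vertDeriv X Y u := by
  have h1 : along D (gamF X) (rhoF (betaF D Y)) u = along D (gamF X) Y u :=
    hD.along_congr hY (fun v hv => rho_beta hD' hv (Y v)) hu
  have h2 : along D (betaF D Y) (rhoF (gamF X)) u = 0 :=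
    hD.along_eq_zero (fun v _ => rho_gam v (X v)) hu
  have h3 := rho_mlieBracket_gamF_betaF hD hD' hX hY hu
  change along D (gamF X) (rhoF (betaF D Y)) u - along D (betaF D Y) (rhoF (gamF X)) u
    - rhoF (mlieBracket 𝓘(ℝ, E).tangent (gamF X) (betaF D Y)) u = _
  rw [h1, h2, h3, sub_zero]

/-- Comparing the fibre product rule for `g(Y, Z)` with `D g = 0` along `γX`, and using `T(X, Y) =
D_{γX} Y` minus the fibre derivative, the third derivative equals `g(T(X, Y), Z) + g(T(X, Z), Y)`;
the Cartan condition makes the two terms equal. -/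
lemma two_mul_metricF_T (hL : IsFinsler L) (hD : IsCartan L D) (hX : IsPiVectorField X)
    (hY : IsPiVectorField Y) (hZ : IsPiVectorField Z) (hu : u ∈ slit E M) :
    2 * metricF L (T D X Y) Z u = cartanForm L u (X u) (Y u) (Z u) := by
  have hlin := hD.isLinearConnection
  have hreg := hD.isRegular
  have h1 := hD.metric_parallel Y Z hY hZ u hu (gam u (X u))
  have h2 := dirDeriv_gamF_metricF (X := X) hL hY hZ (IsSmoothFn.metricF hL hlin hreg hY hZ) hu
  have h3 := h2.symm.trans h1
  have h4 := hD.hv_torsion X Y Z hX hY hZ u hu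
  simp only [metricF, T_eq hlin hreg hX hY hu, T_eq hlin hreg hX hZ hu, metric_sub_left] at h4 ⊢
  rw [hL.metric_symm hu (Y u), hL.metric_symm hu (Y u)] at h3
  simp only [along, gamF] at *
  linarith

/-- The (h)hv-torsion of the Cartan connection is symmetric. -/
lemma T_symm (hL : IsFinsler L) (hD : IsCartan L D) (hX : IsPiVectorField X)
    (hY : IsPiVectorField Y) (hu : u ∈ slit E M) : T D X Y u = T D Y X u := by
  have hlin := hD.isLinearConnection
  have hreg := hD.isRegular
  -- The difference is tested against itself: symmetry of the third derivative makes its `g`-norm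
  -- zero, and `g` is positive definite.
  have hXY : IsPiVectorField (T D X Y - T D Y X) :=
    (isPiVectorField_torsion hlin hX.gamF (hY.betaF hlin hreg)).sub
      (isPiVectorField_torsion hlin hY.gamF (hX.betaF hlin hreg))
  have h1 := two_mul_metricF_T hL hD hX hY hXY hu
  have h2 := two_mul_metricF_T hL hD hY hX hXY hu
  rw [hL.cartanForm_symm hu] at h1
  by_contra hne
  have h3 := hL.posDef u hu (T D X Y u - T D Y X u) (sub_ne_zero.2 hne)
  rw [metric_sub_left] at h3
  have h4 := h1.trans h2.symm
  simp only [metricF, Pi.sub_apply] at h4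
  linarith

end

end

section

variable {X Y Z ζ : PiField E M} {U V W : TMField E M} {f h : TangentBundle 𝓘(ℝ, E) M → ℝ}
  {u : TangentBundle 𝓘(ℝ, E) M} {D : PiConnection E M} {L : TangentBundle 𝓘(ℝ, E) M → ℝ}
  {σ ψ φ : M → ℝ}

lemma dirDeriv_sub (hf : IsSmoothFn f) (hh : IsSmoothFn h) (hu : u ∈ slit E M) :
    dirDeriv W (f - h) u = dirDeriv W f u - dirDeriv W h u :=
  congrArg (fun A => A (W u)) (mvfderiv_sub (hf.mdifferentiableAt hu) (hh.mdifferentiableAt hu))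

lemma dirDeriv_add (hf : IsSmoothFn f) (hh : IsSmoothFn h) (hu : u ∈ slit E M) :
    dirDeriv W (f + h) u = dirDeriv W f u + dirDeriv W h u :=
  congrArg (fun A => A (W u)) (mvfderiv_add (hf.mdifferentiableAt hu) (hh.mdifferentiableAt hu))

lemma dirDeriv_mul (hf : IsSmoothFn f) (hh : IsSmoothFn h) (hu : u ∈ slit E M) :
    dirDeriv W (f * h) u = f u * dirDeriv W h u + h u * dirDeriv W f u :=
  congrArg (fun A => A (W u)) (mvfderiv_mul (hf.mdifferentiableAt hu) (hh.mdifferentiableAt hu))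

lemma IsLinearConnection.along_sub (hD : IsLinearConnection D) (hX : IsPiVectorField X)
    (hY : IsPiVectorField Y) (hu : u ∈ slit E M) :
    PullbackFinsler.along D W (X - Y) u
      = PullbackFinsler.along D W X u - PullbackFinsler.along D W Y u := by
  have h := hD.along_add (W := W) (hX.sub hY) hY hu
  rw [sub_add_cancel] at h
  exact eq_sub_of_add_eq h.symm

/-! ### Curvature -/

lemma IsLinearConnection.curvature_apply (V W : TMField E M) (Z : PiField E M)
    (u : TangentBundle 𝓘(ℝ, E) M) :
    curvature D V W Z u = -PullbackFinsler.along D V (PullbackFinsler.along D W Z) u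
      + PullbackFinsler.along D W (PullbackFinsler.along D V Z) u
      + PullbackFinsler.along D (mlieBracket 𝓘(ℝ, E).tangent V W) Z u := rfl

lemma IsLinearConnection.curvature_congr (hD : IsLinearConnection D)
    (hV : IsSmoothTMField V) (hW : IsSmoothTMField W) (hZ : IsPiVectorField Z)
    (h : ∀ v ∈ slit E M, Y v = Z v) (hu : u ∈ slit E M) :
    PullbackFinsler.curvature D V W Y u = PullbackFinsler.curvature D V W Z u := by
  simp only [curvature_apply]
  rw [hD.along_congr (hD.along hW hZ) (fun v hv => hD.along_congr hZ h hv) hu,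
    hD.along_congr (hD.along hV hZ) (fun v hv => hD.along_congr hZ h hv) hu,
    hD.along_congr hZ h hu]

lemma IsLinearConnection.curvature_eq_zero (hD : IsLinearConnection D)
    (h : ∀ v ∈ slit E M, Z v = 0) (hu : u ∈ slit E M) :
    PullbackFinsler.curvature D V W Z u = 0 := by
  simp only [curvature_apply]
  rw [hD.along_eq_zero (fun v hv => hD.along_eq_zero h hv) hu,
    hD.along_eq_zero (fun v hv => hD.along_eq_zero h hv) hu, hD.along_eq_zero h hu]
  simp

lemma IsLinearConnection.curvature_add (hD : IsLinearConnection D)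
    (hV : IsSmoothTMField V) (hW : IsSmoothTMField W) (hY : IsPiVectorField Y)
    (hZ : IsPiVectorField Z) (hu : u ∈ slit E M) :
    PullbackFinsler.curvature D V W (Y + Z) u
      = PullbackFinsler.curvature D V W Y u + PullbackFinsler.curvature D V W Z u := by
  simp only [curvature_apply]
  rw [hD.along_congr ((hD.along hW hY).add (hD.along hW hZ))
      (fun v hv => hD.along_add hY hZ hv) hu,
    hD.along_congr ((hD.along hV hY).add (hD.along hV hZ))
      (fun v hv => hD.along_add hY hZ hv) hu,
    hD.along_add (hD.along hW hY) (hD.along hW hZ) hu,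
    hD.along_add (hD.along hV hY) (hD.along hV hZ) hu, hD.along_add hY hZ hu]
  abel

/-- First-order terms in `f` cancel by antisymmetry, second-order ones against `[V, W]f`.
Tensoriality is needed to evaluate curvature on `α(Z) ζ + ψ Z`. -/
lemma IsLinearConnection.curvature_smul [CompleteSpace E] (hD : IsLinearConnection D)
    (hV : IsSmoothTMField V) (hW : IsSmoothTMField W) (hf : IsSmoothFn f)
    (hZ : IsPiVectorField Z) (hu : u ∈ slit E M) :
    PullbackFinsler.curvature D V W (f • Z) u = f u • PullbackFinsler.curvature D V W Z u := by
  have key : ∀ {A B : TMField E M}, IsSmoothTMField A → IsSmoothTMField B →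
      PullbackFinsler.along D A (PullbackFinsler.along D B (f • Z)) u
        = f u • PullbackFinsler.along D A (PullbackFinsler.along D B Z) u
          + dirDeriv A f u • PullbackFinsler.along D B Z u
          + (dirDeriv B f u • PullbackFinsler.along D A Z u
          + dirDeriv A (dirDeriv B f) u • Z u) := by
    intro A B hA hB
    rw [hD.along_congr (((hD.along hB hZ).smul hf).add (hZ.smul (hB.dirDeriv hf)))
        (fun v hv => hD.along_smul hf hZ hv) hu,
      hD.along_add ((hD.along hB hZ).smul hf) (hZ.smul (hB.dirDeriv hf)) hu,
      hD.along_smul hf (hD.along hB hZ) hu, hD.along_smul (hB.dirDeriv hf) hZ hu]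
  simp only [curvature_apply]
  rw [key hV hW, key hW hV, hD.along_smul hf hZ hu, mvfderiv_mlieBracket hf hV hW hu]
  module

/-- The curvature of a metric connection is skew-symmetric. -/
lemma metric_curvature_left [FiniteDimensional ℝ E] [T2Space M] (hL : IsFinsler L)
    (hD : IsCartan L D) (hV : IsSmoothTMField V) (hW : IsSmoothTMField W)
    (hY : IsPiVectorField Y) (hZ : IsPiVectorField Z) (hu : u ∈ slit E M) :
    metricF L (curvature D V W Y) Z u = -metricF L (curvature D V W Z) Y u := by
  have : CompleteSpace E := FiniteDimensional.complete ℝ E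
  have hlin := hD.isLinearConnection
  have hg : ∀ {A B : PiField E M}, IsPiVectorField A → IsPiVectorField B →
      IsSmoothFn (metricF L A B) := IsSmoothFn.metricF hL hlin hD.isRegular
  have h1 : ∀ {A : TMField E M} {B C : PiField E M}, IsPiVectorField B → IsPiVectorField C →
      ∀ v ∈ slit E M, dirDeriv A (metricF L B C) v
        = metricF L (along D A B) C v + metricF L B (along D A C) v :=
    fun hB hC v hv => hD.metric_parallel _ _ hB hC v hv _
  have key : ∀ {A B : TMField E M}, IsSmoothTMField A → IsSmoothTMField B →
      dirDeriv A (dirDeriv B (metricF L Y Z)) u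
        = metricF L (along D A (along D B Y)) Z u + metricF L (along D B Y) (along D A Z) u
          + (metricF L (along D A Y) (along D B Z) u
            + metricF L Y (along D A (along D B Z)) u) := by
    intro A B hA hB
    rw [dirDeriv_congr (h := metricF L (along D B Y) Z + metricF L Y (along D B Z))
      (h1 hY hZ) hu, dirDeriv_add (hg (hlin.along hB hY) hZ) (hg hY (hlin.along hB hZ)) hu,
      h1 (hlin.along hB hY) hZ u hu, h1 hY (hlin.along hB hZ) u hu]
  -- Both sides are `[V, W]` acting on `g(Y, Z)`; the mixed terms `g(D_V Y, D_W Z)` cancel in the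
  -- commutator.
  have h2 := mvfderiv_mlieBracket (hg hY hZ) hV hW hu
  rw [key hV hW, key hW hV, h1 hY hZ u hu] at h2
  simp only [metricF, IsLinearConnection.curvature_apply, metric_add_left, metric_neg_left] at h2 ⊢
  rw [hL.metric_symm hu (Y u), hL.metric_symm hu (Y u), hL.metric_symm hu (Y u)] at h2
  linarith

lemma rhoF_gamF (X : PiField E M) : rhoF (gamF X) u = 0 :=
  rho_gam u (X u)

lemma torsion_swap (V W : TMField E M) : torsion D V W u = -torsion D W V u := by
  have h2 : ∀ A B, torsion D A B u = along D A (rhoF B) u - along D B (rhoF A) u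
    - rho u (mlieBracket 𝓘(ℝ, E).tangent A B u) := fun _ _ => rfl
  rw [h2, h2, mlieBracket_swap_apply, map_neg]
  abel

/-! ### Covariant derivatives of tensors -/

lemma covTensor₂_congr {A B : PiField E M → PiField E M → PiField E M}
    (hD : IsLinearConnection D) (hW : IsSmoothTMField W)
    (h : ∀ X Y, IsPiVectorField X → IsPiVectorField Y → ∀ v ∈ slit E M, A X Y v = B X Y v)
    (hX : IsPiVectorField X) (hY : IsPiVectorField Y) (hB : IsPiVectorField (B X Y))
    (hu : u ∈ slit E M) : covTensor₂ D W A X Y u = covTensor₂ D W B X Y u := by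
  have h1 : ∀ C : PiField E M → PiField E M → PiField E M, covTensor₂ D W C X Y u
    = along D W (C X Y) u - C (along D W X) Y u - C X (along D W Y) u := fun _ => rfl
  rw [h1, h1, hD.along_congr hB (h X Y hX hY) hu, h _ _ (hD.along hW hX) hY u hu,
    h _ _ hX (hD.along hW hY) u hu]

lemma covTensor₂_zero (hD : IsLinearConnection D) (hu : u ∈ slit E M) :
    covTensor₂ D W (fun _ _ => 0) X Y u = 0 := by
  have h1 : covTensor₂ D W (fun _ _ => 0) X Y u = along D W 0 u - 0 - 0 := rfl
  rw [h1, hD.along_eq_zero (Y := 0) (fun _ _ => rfl) hu]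
  simp

lemma covTensor₂_smul {A : PiField E M → PiField E M → PiField E M}
    (hD : IsLinearConnection D) (hf : IsSmoothFn f) (hA : IsPiVectorField (A X Y))
    (hu : u ∈ slit E M) : covTensor₂ D W (fun X Y => f • A X Y) X Y u
      = f u • covTensor₂ D W A X Y u + dirDeriv W f u • A X Y u := by
  have h1 : ∀ C : PiField E M → PiField E M → PiField E M, covTensor₂ D W C X Y u
    = along D W (C X Y) u - C (along D W X) Y u - C X (along D W Y) u := fun _ => rfl
  rw [h1, h1, hD.along_smul hf hA hu]
  simp only [Pi.smul_apply']
  module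

/-- The covariant derivative of `(X, Y) ↦ A(Y) X - A(X) Y` for a scalar form `A`. -/
lemma covTensor₂_wedge {A : PiField E M → TangentBundle 𝓘(ℝ, E) M → ℝ}
    (hD : IsLinearConnection D) (hX : IsPiVectorField X) (hY : IsPiVectorField Y)
    (hAX : IsSmoothFn (A X)) (hAY : IsSmoothFn (A Y)) (hu : u ∈ slit E M) :
    covTensor₂ D W (fun X Y => A Y • X - A X • Y) X Y u
      = covForm D W A Y u • X u - covForm D W A X u • Y u := by
  have h1 : ∀ C : PiField E M → PiField E M → PiField E M, covTensor₂ D W C X Y u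
    = along D W (C X Y) u - C (along D W X) Y u - C X (along D W Y) u := fun _ => rfl
  rw [h1, hD.along_sub (hX.smul hAY) (hY.smul hAX) hu, hD.along_smul hAY hX hu,
    hD.along_smul hAX hY hu]
  simp only [Pi.smul_apply', Pi.sub_apply, covForm]
  module

/-- The last-slot term drops out since `D_{γZ} ζ = 0`. Leaving `F` and `G` free covers `S`, `P` and
`R` at once. -/
lemma covTensor₃_curvature_gamF {F G : PiField E M → TMField E M}
    (hζ : IsConcircular D σ ψ ζ) (hD : IsLinearConnection D) (hZ : IsPiVectorField Z)
    (hu : u ∈ slit E M) :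
    covTensor₃ D (gamF Z) (fun X Y => curvature D (F X) (G Y)) X Y ζ u
      = covTensor₂ D (gamF Z) (fun X Y => curvature D (F X) (G Y) ζ) X Y u := by
  have h1 : covTensor₃ D (gamF Z) (fun X Y => curvature D (F X) (G Y)) X Y ζ u
      = covTensor₂ D (gamF Z) (fun X Y => curvature D (F X) (G Y) ζ) X Y u
        - curvature D (F X) (G Y) (along D (gamF Z) ζ) u := rfl
  rw [h1, hD.curvature_eq_zero (fun v hv => hζ.along_gam Z hZ v hv) hu, sub_zero]

end

section

variable {X Y Z ζ : PiField E M} {U V W : TMField E M} {f h : TangentBundle 𝓘(ℝ, E) M → ℝ}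
  {u : TangentBundle 𝓘(ℝ, E) M} {D : PiConnection E M} {L : TangentBundle 𝓘(ℝ, E) M → ℝ}
  {σ ψ φ : M → ℝ} [FiniteDimensional ℝ E]

/-! ### Horizontal derivatives of functions on the base -/

lemma hForm_eq_baseDeriv (hD : IsRegular D) (hφ : ContMDiff 𝓘(ℝ, E) 𝓘(ℝ, ℝ) ∞ φ)
    (hu : u ∈ slit E M) (X : PiField E M) : hForm D φ X u = baseDeriv φ u (X u) := by
  rw [hForm, dirDeriv_comp_proj hφ]
  exact congrArg _ (rho_beta hD hu (X u))

lemma isSmoothFn_hForm (hD : IsLinearConnection D) (hD' : IsRegular D)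
    (hφ : ContMDiff 𝓘(ℝ, E) 𝓘(ℝ, ℝ) ∞ φ) (hX : IsPiVectorField X) : IsSmoothFn (hForm D φ X) :=
  (hX.betaF hD hD').dirDeriv (isSmoothFn_comp_proj hφ)

/-- Along `γZ` the function `dφ(Y)` changes by `dφ` of the fibre derivative of `Y`; subtracting
`dφ(D_{γZ} Y)` leaves `-dφ(T(Z, Y))` by `T_eq`. -/
lemma covForm_gamF_hForm [T2Space M] (hD : IsLinearConnection D) (hD' : IsRegular D)
    (hφ : ContMDiff 𝓘(ℝ, E) 𝓘(ℝ, ℝ) ∞ φ) (hY : IsPiVectorField Y) (hZ : IsPiVectorField Z)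
    (hu : u ∈ slit E M) :
    covForm D (gamF Z) (hForm D φ) Y u = -hForm D φ (T D Z Y) u := by
  have hs : IsSmoothFn (fun v => baseDeriv φ v (Y v)) :=
    (isSmoothFn_hForm hD hD' hφ hY).congr fun v hv => (hForm_eq_baseDeriv hD' hφ hv Y).symm
  have h1 : covForm D (gamF Z) (hForm D φ) Y u
      = dirDeriv (gamF Z) (hForm D φ Y) u - hForm D φ (along D (gamF Z) Y) u := rfl
  rw [h1, dirDeriv_congr (fun v hv => hForm_eq_baseDeriv hD' hφ hv Y) hu,
    dirDeriv_gamF_baseDeriv hY hu hs, hForm_eq_baseDeriv hD' hφ hu, hForm_eq_baseDeriv hD' hφ hu,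
    T_eq hD hD' hZ hY hu, map_sub]
  ring

/-! ### Concircular fields -/

/-- The defining equations concern only fields `βX` and `γX`. At a point, the two components of `W`
extend to `π`-vector fields, so the equations apply to each and add up. -/
lemma IsConcircular.along_eq [T2Space M] (hζ : IsConcircular D σ ψ ζ) (hD : IsRegular D)
    (W : TMField E M) (hu : u ∈ slit E M) :
    along D W ζ u = (dirDeriv W (σ ∘ proj E M) • ζ + (ψ ∘ proj E M) • rhoF W) u := by
  obtain ⟨v, hv⟩ := exists_eq_beta_add_gam hD hu (W u)
  obtain ⟨A, hA, hAu⟩ := exists_isPiVectorField u (rho u (W u))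
  obtain ⟨B, hB, hBu⟩ := exists_isPiVectorField u v
  have h1 := hζ.along_beta A hA u hu
  have h2 := hζ.along_gam B hB u hu
  rw [hForm_eq_baseDeriv hD hζ.contMDiff_sigma hu] at h1
  simp only [along, betaF, gamF, hAu, hBu] at h1 h2
  have h3 : along D W ζ u = baseDeriv σ u (rho u (W u)) • ζ u + ψ u.proj • rho u (W u) := by
    rw [along]
    nth_rewrite 1 [hv]
    rw [map_add, h1, h2, add_zero]
  rw [h3, ← dirDeriv_comp_proj hζ.contMDiff_sigma]
  rfl

/-- The source of all the curvature identities. The coefficient of `ζ` cancels because the products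
of first derivatives of `σ` are symmetric and `[V, W]σ` is the commutator; the terms carrying `ψ`
and no derivative of `σ` or `ψ` assemble into the torsion. -/
lemma IsConcircular.curvature_eq [T2Space M] (hζ : IsConcircular D σ ψ ζ)
    (hD : IsLinearConnection D) (hD' : IsRegular D) (hV : IsSmoothTMField V)
    (hW : IsSmoothTMField W) (hu : u ∈ slit E M) :
    curvature D V W ζ u
      = (dirDeriv W (ψ ∘ proj E M) u - ψ u.proj * dirDeriv W (σ ∘ proj E M) u) • rhoF V u
        - (dirDeriv V (ψ ∘ proj E M) u - ψ u.proj * dirDeriv V (σ ∘ proj E M) u) • rhoF W u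
        - ψ u.proj • torsion D V W u := by
  have : CompleteSpace E := FiniteDimensional.complete ℝ E
  have hσ' := isSmoothFn_comp_proj hζ.contMDiff_sigma
  have hψ' := isSmoothFn_comp_proj hζ.contMDiff_psi
  have hz := hζ.isPiVectorField
  have key : ∀ {A B : TMField E M}, IsSmoothTMField A → IsSmoothTMField B →
      along D A (along D B ζ) u
        = dirDeriv B (σ ∘ proj E M) u • (dirDeriv A (σ ∘ proj E M) u • ζ u
            + ψ u.proj • rhoF A u)
          + dirDeriv A (dirDeriv B (σ ∘ proj E M)) u • ζ u
          + (ψ u.proj • along D A (rhoF B) u + dirDeriv A (ψ ∘ proj E M) u • rhoF B u) := by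
    intro A B hA hB
    rw [hD.along_congr ((hz.smul (hB.dirDeriv hσ')).add (hB.rhoF.smul hψ'))
        (fun v hv => hζ.along_eq hD' B hv) hu,
      hD.along_add (hz.smul (hB.dirDeriv hσ')) (hB.rhoF.smul hψ') hu,
      hD.along_smul (hB.dirDeriv hσ') hz hu, hD.along_smul hψ' hB.rhoF hu, hζ.along_eq hD' A hu]
    rfl
  have h1 : along D (mlieBracket 𝓘(ℝ, E).tangent V W) ζ u
      = dirDeriv (mlieBracket 𝓘(ℝ, E).tangent V W) (σ ∘ proj E M) u • ζ u
        + ψ u.proj • rhoF (mlieBracket 𝓘(ℝ, E).tangent V W) u := hζ.along_eq hD' _ hu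
  have h2 : torsion D V W u = along D V (rhoF W) u - along D W (rhoF V) u
    - rhoF (mlieBracket 𝓘(ℝ, E).tangent V W) u := rfl
  rw [IsLinearConnection.curvature_apply, key hV hW, key hW hV, h1, h2,
    mvfderiv_mlieBracket hσ' hV hW hu]
  module

lemma torsion_gamF_gamF [T2Space M] (hD : IsLinearConnection D) (hX : IsPiVectorField X)
    (hY : IsPiVectorField Y) (hu : u ∈ slit E M) : torsion D (gamF X) (gamF Y) u = 0 := by
  have h1 : torsion D (gamF X) (gamF Y) u = along D (gamF X) (rhoF (gamF Y)) u
    - along D (gamF Y) (rhoF (gamF X)) u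
    - rhoF (mlieBracket 𝓘(ℝ, E).tangent (gamF X) (gamF Y)) u := rfl
  rw [h1, hD.along_eq_zero (Y := rhoF (gamF Y)) (fun _ _ => rhoF_gamF Y) hu,
    hD.along_eq_zero (Y := rhoF (gamF X)) (fun _ _ => rhoF_gamF X) hu,
    rho_mlieBracket_gamF_gamF hX hY hu]
  simp

lemma rhoF_betaF (hD : IsRegular D) (hu : u ∈ slit E M) : rhoF (betaF D X) u = X u :=
  rho_beta hD hu (X u)

lemma IsConcircular.S_eq [T2Space M] (hζ : IsConcircular D σ ψ ζ) (hD : IsCartan L D)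
    (hX : IsPiVectorField X) (hY : IsPiVectorField Y) (hu : u ∈ slit E M) :
    S D X Y ζ u = 0 := by
  rw [S, hζ.curvature_eq hD.isLinearConnection hD.isRegular hX.gamF hY.gamF hu,
    torsion_gamF_gamF hD.isLinearConnection hX hY hu, rhoF_gamF, rhoF_gamF]
  simp

/-- Only the torsion term survives. Exchanging its arguments produces `ψ T(Y, X)`, with `X` and `Y`
in the wrong order, so `T_symm` is essential. -/
lemma IsConcircular.P_eq [T2Space M] (hζ : IsConcircular D σ ψ ζ) (hL : IsFinsler L)
    (hD : IsCartan L D) (hX : IsPiVectorField X) (hY : IsPiVectorField Y) (hu : u ∈ slit E M) :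
    P D X Y ζ u = ψ u.proj • T D X Y u := by
  rw [P, hζ.curvature_eq hD.isLinearConnection hD.isRegular
      (hX.betaF hD.isLinearConnection hD.isRegular) hY.gamF hu,
    dirDeriv_gamF_comp_proj hζ.contMDiff_sigma, dirDeriv_gamF_comp_proj hζ.contMDiff_psi,
    torsion_swap, rhoF_gamF, T_symm hL hD hX hY hu, T]
  simp

lemma IsConcircular.R_eq [T2Space M] (hζ : IsConcircular D σ ψ ζ)
    (hD : IsCartan L D) (hX : IsPiVectorField X) (hY : IsPiVectorField Y) (hu : u ∈ slit E M) :
    R D X Y ζ u = (hForm D ψ Y u - ψ u.proj * hForm D σ Y u) • X u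
      - (hForm D ψ X u - ψ u.proj * hForm D σ X u) • Y u := by
  have hQ : torsion D (betaF D X) (betaF D Y) u = 0 := hD.hh_torsion X Y hX hY u hu
  rw [R, hζ.curvature_eq hD.isLinearConnection hD.isRegular
      (hX.betaF hD.isLinearConnection hD.isRegular)
      (hY.betaF hD.isLinearConnection hD.isRegular) hu, hQ,
    rhoF_betaF hD.isRegular hu, rhoF_betaF hD.isRegular hu, smul_zero, sub_zero]
  rfl

/-! ### Covariant derivatives of curvature tensors -/

/-- The Leibniz rule with `D_{βZ} ζ = α(Z) ζ + ψ Z` in the last slot, split by tensoriality of the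
curvature. -/
lemma covTensor₃_curvature_betaF {F G : PiField E M → TMField E M}
    (hζ : IsConcircular D σ ψ ζ) (hD : IsLinearConnection D) (hD' : IsRegular D)
    (hF : IsSmoothTMField (F X)) (hG : IsSmoothTMField (G Y)) (hZ : IsPiVectorField Z)
    (hu : u ∈ slit E M) :
    covTensor₃ D (betaF D Z) (fun X Y => curvature D (F X) (G Y)) X Y ζ u
      = covTensor₂ D (betaF D Z) (fun X Y => curvature D (F X) (G Y) ζ) X Y u
        - (hForm D σ Z u • curvature D (F X) (G Y) ζ u
          + ψ u.proj • curvature D (F X) (G Y) Z u) := by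
  have : CompleteSpace E := FiniteDimensional.complete ℝ E
  have h1 : covTensor₃ D (betaF D Z) (fun X Y => curvature D (F X) (G Y)) X Y ζ u
      = covTensor₂ D (betaF D Z) (fun X Y => curvature D (F X) (G Y) ζ) X Y u
        - curvature D (F X) (G Y) (along D (betaF D Z) ζ) u := rfl
  have hs := isSmoothFn_hForm hD hD' hζ.contMDiff_sigma hZ
  have hp := isSmoothFn_comp_proj hζ.contMDiff_psi
  rw [h1, hD.curvature_congr (Z := hForm D σ Z • ζ + (ψ ∘ proj E M) • Z) hF hG
      ((hζ.isPiVectorField.smul hs).add (hZ.smul hp)) (fun v hv => hζ.along_beta Z hZ v hv) hu,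
    hD.curvature_add hF hG (hζ.isPiVectorField.smul hs) (hZ.smul hp) hu,
    hD.curvature_smul hF hG hs hζ.isPiVectorField hu, hD.curvature_smul hF hG hp hZ hu]
  rfl

lemma IsConcircular.covTensor₂_S [T2Space M] (hζ : IsConcircular D σ ψ ζ) (hD : IsCartan L D)
    (hX : IsPiVectorField X) (hY : IsPiVectorField Y) (hW : IsSmoothTMField W)
    (hu : u ∈ slit E M) : covTensor₂ D W (fun X Y => S D X Y ζ) X Y u = 0 := by
  rw [covTensor₂_congr (B := fun _ _ => 0) hD.isLinearConnection hW
      (fun A B hA hB v hv => hζ.S_eq hD hA hB hv) hX hY IsPiVectorField.zero hu,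
    covTensor₂_zero hD.isLinearConnection hu]

lemma IsConcircular.covTensor₂_P [T2Space M] (hζ : IsConcircular D σ ψ ζ) (hL : IsFinsler L)
    (hD : IsCartan L D) (hX : IsPiVectorField X) (hY : IsPiVectorField Y) (hW : IsSmoothTMField W)
    (hu : u ∈ slit E M) : covTensor₂ D W (fun X Y => P D X Y ζ) X Y u
      = ψ u.proj • covTensor₂ D W (T D) X Y u + dirDeriv W (ψ ∘ proj E M) u • T D X Y u := by
  have hp := isSmoothFn_comp_proj hζ.contMDiff_psi
  have hT : IsPiVectorField (T D X Y) := isPiVectorField_torsion hD.isLinearConnection hX.gamF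
    (hY.betaF hD.isLinearConnection hD.isRegular)
  rw [covTensor₂_congr (B := fun X Y => (ψ ∘ proj E M) • T D X Y) hD.isLinearConnection hW
      (fun A B hA hB v hv => hζ.P_eq hL hD hA hB hv) hX hY (hT.smul hp) hu,
    covTensor₂_smul hD.isLinearConnection hp hT hu]
  rfl

lemma IsConcircular.covTensor₂_R [T2Space M] (hζ : IsConcircular D σ ψ ζ)
    (hD : IsCartan L D) (hX : IsPiVectorField X) (hY : IsPiVectorField Y) (hW : IsSmoothTMField W)
    (hu : u ∈ slit E M) : covTensor₂ D W (fun X Y => R D X Y ζ) X Y u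
      = altSum (fun X Y => (covForm D W (hForm D ψ) Y u - ψ u.proj * covForm D W (hForm D σ) Y u
          - dirDeriv W (ψ ∘ proj E M) u * hForm D σ Y u) • X u) X Y := by
  have hlin := hD.isLinearConnection
  have hp := isSmoothFn_comp_proj hζ.contMDiff_psi
  have hμ : ∀ {A}, IsPiVectorField A → IsSmoothFn (hForm D ψ A) :=
    isSmoothFn_hForm hlin hD.isRegular hζ.contMDiff_psi
  have hα : ∀ {A}, IsPiVectorField A → IsSmoothFn (hForm D σ A) :=
    isSmoothFn_hForm hlin hD.isRegular hζ.contMDiff_sigma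
  -- The form `μ - ψα`, whose wedge with the identity is `R(·, ·)ζ`; differentiating the factor `ψ`
  -- gives the term `-(Wψ) α(Y)`.
  let A : PiField E M → TangentBundle 𝓘(ℝ, E) M → ℝ :=
    fun X => hForm D ψ X - (ψ ∘ proj E M) * hForm D σ X
  have hA : ∀ {B}, IsPiVectorField B → IsSmoothFn (A B) := fun hB => (hμ hB).sub (hp.mul (hα hB))
  have hcov : ∀ {B}, IsPiVectorField B → covForm D W A B u
      = covForm D W (hForm D ψ) B u - ψ u.proj * covForm D W (hForm D σ) B u
        - dirDeriv W (ψ ∘ proj E M) u * hForm D σ B u := by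
    intro B hB
    have h1 : ∀ C : PiField E M → TangentBundle 𝓘(ℝ, E) M → ℝ,
      covForm D W C B u = dirDeriv W (C B) u - C (along D W B) u := fun _ => rfl
    have h2 : A (along D W B) u
      = hForm D ψ (along D W B) u - ψ u.proj * hForm D σ (along D W B) u := rfl
    have h3 : (ψ ∘ proj E M) u = ψ u.proj := rfl
    rw [h1, h1, h1, h2, dirDeriv_sub (hμ hB) (hp.mul (hα hB)) hu, dirDeriv_mul hp (hα hB) hu, h3]
    ring
  rw [covTensor₂_congr (B := fun X Y => A Y • X - A X • Y) hlin hW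
      (fun A B hA hB v hv => hζ.R_eq hD hA hB hv) hX hY ((hX.smul (hA hY)).sub (hY.smul (hA hX))) hu,
    covTensor₂_wedge hlin hX hY (hA hX) (hA hY) hu, hcov hX, hcov hY]
  rfl

end

end PullbackFinsler

end

/-! ### Assembly of the thirteen identities. -/

open PullbackFinsler in
theorem theorem2
    {E : Type*} [NormedAddCommGroup E] [NormedSpace ℝ E] [FiniteDimensional ℝ E]
    {M : Type*} [TopologicalSpace M] [T2Space M] [SecondCountableTopology M]
    [ChartedSpace E M] [IsManifold 𝓘(ℝ, E) ∞ M]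
    (L : TangentBundle 𝓘(ℝ, E) M → ℝ) (hL : IsFinsler L)
    (D : PiConnection E M) (hD : IsCartan L D)
    (σ ψ : M → ℝ) (ζ : PiField E M) (hζ : IsConcircular D σ ψ ζ)
    (α μ : PiField E M → TangentBundle 𝓘(ℝ, E) M → ℝ)
    (hα : α = hForm D σ) (hμ : μ = hForm D ψ)
    (X Y Z : PiField E M)
    (hX : IsPiVectorField X) (hY : IsPiVectorField Y) (hZ : IsPiVectorField Z)
    (u : TangentBundle 𝓘(ℝ, E) M) (hu : u ∈ slit E M)
    (p : ℝ) (hp : p = ψ u.proj) :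
    -- (a)
    (S D X Y ζ u = 0 ∧ metricF L (S D X Y Z) ζ u = 0) ∧
    -- (b)
    covTensor₃ D (gamF Z) (S D) X Y ζ u = 0 ∧
    -- (c)
    covTensor₃ D (betaF D Z) (S D) X Y ζ u = -(p • S D X Y Z u) ∧
    -- (d)
    covTensor₃ D (betaF D ζ) (S D) X Y ζ u = 0 ∧
    -- (e)
    (P D X Y ζ u = p • T D X Y u ∧
      metricF L (P D X Y Z) ζ u = -(p * metricF L (T D X Y) Z u)) ∧
    -- (f)
    covTensor₃ D (gamF Z) (P D) X Y ζ u = p • covTensor₂ D (gamF Z) (T D) X Y u ∧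
    -- (g)
    covTensor₃ D (betaF D Z) (P D) X Y ζ u
      = (μ Z u - p * α Z u) • T D X Y u + p • covTensor₂ D (betaF D Z) (T D) X Y u
        - p • P D X Y Z u ∧
    -- (h)
    covTensor₃ D (betaF D ζ) (P D) X Y ζ u
      = (μ ζ u - p * α ζ u - p ^ 2) • T D X Y u + p • covTensor₂ D (betaF D ζ) (T D) X Y u ∧
    -- (i)
    R D X Y ζ u = altSum (fun X Y => (μ Y u - p * α Y u) • X u) X Y ∧
    -- (j)
    metricF L (R D X Y Z) ζ u
      = altSum (fun X Y => (μ X u - p * α X u) * metricF L Y Z u) X Y ∧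
    -- (k)
    covTensor₃ D (gamF Z) (R D) X Y ζ u
      = -altSum (fun X Y => (μ (T D Z Y) u - p * α (T D Z Y) u) • X u) X Y ∧
    -- (l)
    covTensor₃ D (betaF D Z) (R D) X Y ζ u
      = altSum (fun X Y => (covForm D (betaF D Z) μ Y u - p * covForm D (betaF D Z) α Y u
            + p * α Z u * α Y u) • X u) X Y
        - altSum (fun X Y => (μ Z u * α Y u + α Z u * μ Y u) • X u) X Y
        - p • R D X Y Z u ∧
    -- (m)
    covTensor₃ D (betaF D ζ) (R D) X Y ζ u
      = altSum (fun X Y => (covForm D (betaF D ζ) μ Y u - p * covForm D (betaF D ζ) α Y u)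
            • X u) X Y
        - altSum (fun X Y => (μ ζ u * α Y u + α ζ u * μ Y u) • X u) X Y
        + altSum (fun X Y => (p * α ζ u * α Y u - p * μ Y u + p ^ 2 * α Y u) • X u) X Y := by
  subst hα hμ hp
  have hlin := hD.isLinearConnection
  have hreg := hD.isRegular
  have hz := hζ.isPiVectorField
  have hβ : ∀ {A : PiField E M}, IsPiVectorField A → IsSmoothTMField (betaF D A) :=
    fun hA => hA.betaF hlin hreg
  -- The horizontal formulas are proved for an arbitrary `π`-vector field `A`, since both `A = Z`
  -- and `A = ζ` are needed.
  have hS : ∀ {A : PiField E M}, IsPiVectorField A →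
      covTensor₃ D (betaF D A) (S D) X Y ζ u = -(ψ u.proj • S D X Y A u) := fun {A} hA => by
    have h := covTensor₃_curvature_betaF (F := gamF) (G := gamF) hζ hlin hreg hX.gamF hY.gamF hA hu
    have h1 := hζ.covTensor₂_S hD hX hY (hβ hA) hu
    have h2 := hζ.S_eq hD hX hY hu
    simp only [S] at h1 h2 ⊢
    rw [h1, h2, smul_zero, zero_add, zero_sub] at h
    exact h
  have hP : ∀ {A : PiField E M}, IsPiVectorField A →
      covTensor₃ D (betaF D A) (P D) X Y ζ u
        = (hForm D ψ A u - ψ u.proj * hForm D σ A u) • T D X Y u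
          + ψ u.proj • covTensor₂ D (betaF D A) (T D) X Y u - ψ u.proj • P D X Y A u :=
    fun {A} hA => by
    have h := covTensor₃_curvature_betaF (F := betaF D) (G := gamF) hζ hlin hreg (hβ hX) hY.gamF
      hA hu
    have h1 := hζ.covTensor₂_P hL hD hX hY (hβ hA) hu
    have h2 := hζ.P_eq hL hD hX hY hu
    have h3 : dirDeriv (betaF D A) (ψ ∘ proj E M) u = hForm D ψ A u := rfl
    simp only [P] at h1 h2 ⊢
    rw [h1, h2, h3] at h
    refine h.trans ?_
    module
  have hR : ∀ {A : PiField E M}, IsPiVectorField A →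
      covTensor₃ D (betaF D A) (R D) X Y ζ u
        = altSum (fun X Y => (covForm D (betaF D A) (hForm D ψ) Y u
              - ψ u.proj * covForm D (betaF D A) (hForm D σ) Y u
              + ψ u.proj * hForm D σ A u * hForm D σ Y u) • X u) X Y
          - altSum (fun X Y => (hForm D ψ A u * hForm D σ Y u
              + hForm D σ A u * hForm D ψ Y u) • X u) X Y
          - ψ u.proj • R D X Y A u := fun {A} hA => by
    have h := covTensor₃_curvature_betaF (F := betaF D) (G := betaF D) hζ hlin hreg (hβ hX) (hβ hY)
      hA hu
    have h1 := hζ.covTensor₂_R hD hX hY (hβ hA) hu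
    have h2 := hζ.R_eq hD hX hY hu
    have h3 : dirDeriv (betaF D A) (ψ ∘ proj E M) u = hForm D ψ A u := rfl
    simp only [R] at h1 h2 ⊢
    rw [h1, h2, h3] at h
    refine h.trans ?_
    -- The term `-α(A) R(X, Y)ζ` supplies `ψ α(A) α(Y)` and `-α(A) μ(Y)`; the term `-μ(A) α(Y)`
    -- comes from differentiating `ψ`.
    simp only [altSum]
    module
  refine ⟨⟨hζ.S_eq hD hX hY hu, ?_⟩, ?_, hS hZ, ?_, ⟨hζ.P_eq hL hD hX hY hu, ?_⟩, ?_, hP hZ, ?_,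
    hζ.R_eq hD hX hY hu, ?_, ?_, hR hZ, ?_⟩
  · refine (metric_curvature_left hL hD hX.gamF hY.gamF hZ hz hu).trans ?_
    have h := hζ.S_eq hD hX hY hu
    simp only [S] at h
    -- The zero vector is written as `0 • 0` so that linearity of `metric` in its first slot
    -- applies.
    rw [metricF, h, ← zero_smul ℝ (0 : PiBundle E M u), metric_smul_left, zero_mul, neg_zero]
  · exact (covTensor₃_curvature_gamF (F := gamF) (G := gamF) hζ hlin hZ hu).trans
      (hζ.covTensor₂_S hD hX hY hZ.gamF hu)
  · rw [hS hz, hζ.S_eq hD hX hY hu, smul_zero, neg_zero]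
  · refine (metric_curvature_left hL hD (hβ hX) hY.gamF hZ hz hu).trans ?_
    have h := hζ.P_eq hL hD hX hY hu
    simp only [P] at h
    rw [metricF, h, metric_smul_left]
    rfl
  · refine (covTensor₃_curvature_gamF (F := betaF D) (G := gamF) hζ hlin hZ hu).trans
      ((hζ.covTensor₂_P hL hD hX hY hZ.gamF hu).trans ?_)
    rw [dirDeriv_gamF_comp_proj hζ.contMDiff_psi, zero_smul, add_zero]
  -- With `ζ` in place of `Z`, the term `-ψ P(X, Y)ζ` becomes `-ψ² T(X, Y)`.
  · rw [hP hz, hζ.P_eq hL hD hX hY hu]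
    module
  · refine (metric_curvature_left hL hD (hβ hX) (hβ hY) hZ hz hu).trans ?_
    have h := hζ.R_eq hD hX hY hu
    simp only [R] at h
    rw [metricF, h, metric_sub_left, metric_smul_left, metric_smul_left]
    simp only [altSum, metricF]
    ring
  · refine (covTensor₃_curvature_gamF (F := betaF D) (G := betaF D) hζ hlin hZ hu).trans
      ((hζ.covTensor₂_R hD hX hY hZ.gamF hu).trans ?_)
    simp only [altSum]
    rw [dirDeriv_gamF_comp_proj hζ.contMDiff_psi,
      covForm_gamF_hForm hlin hreg hζ.contMDiff_psi hY hZ hu,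
      covForm_gamF_hForm hlin hreg hζ.contMDiff_psi hX hZ hu,
      covForm_gamF_hForm hlin hreg hζ.contMDiff_sigma hY hZ hu,
      covForm_gamF_hForm hlin hreg hζ.contMDiff_sigma hX hZ hu]
    module
  -- Here `-ψ R(X, Y)ζ` contributes `-ψ μ(Y) + ψ² α(Y)` to the coefficient of `X` in the last
  -- alternating sum.
  · rw [hR hz, hζ.R_eq hD hX hY hu]
    simp only [altSum]
    module
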